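/- Let $(M,\omega)$ be a symplectic manifold, $J_M$ an almost complex structure and $g_M$ a Riemannian metric on $M$ with $\omega(X,Y)=g_M(J_MX,Y)$ for all $X,Y\in TM$. Let a Lie group $G$ with Lie algebra $\mathfrak g$ act smoothly on $M$ by isometries of $g_M$, and let the action be Hamiltonian: it preserves $\omega$ and has an $\mathrm{Ad}^*$-equivariant momentum map $\mu:M\to\mathfrak g^*$, $d\langle\mu,\xi\rangle=\omega(\xi_M,\cdot)$ for $\xi\in\mathfrak g$. Let $\beta\in\mathfrak g^*$ be a regular value of $\mu$, so that $\mu^{-1}(\beta)$ is an embedded submanifold, with inclusion $i:\mu^{-1}(\beta)\to M$, and $d\mu$ is onto at its points. Let the isotropy group $G_\beta$ of $\beta$ for the coadjoint action act freely and properly on $\mu^{-1}(\beta)$. Equip the quotient space $B=\mu^{-1}(\beta)/G_\beta$ with its quotient manifold structure, that is, the one for which the projection $\pi:\mu^{-1}(\beta)\to B$ is a smooth submersion. For $u\in T\mu^{-1}(\beta)$ let $J'u\in T\mu^{-1}(\beta)$ be the tangential part of $J_Mu$, that is, its $g_M$-orthogonal projection to $T\mu^{-1}(\beta)$; so $J'$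 is the unique field of endomorphisms of $T\mu^{-1}(\beta)$ with $i^*\omega=i^*g_M(J'\cdot,\cdot)$. For an almost complex structure $J_\beta$ on $B$, call $\pi$ an almost complex mapping to $(B,J_\beta)$ if $d\pi\circ J'=J_\beta\circ d\pi$ on $T\mu^{-1}(\beta)$. There is a unique symplectic form $\omega_\beta$ on $B$ with $\pi^*\omega_\beta=i^*\omega$. For every smooth almost complex structure $J_\beta$ on $B$, there exists a Riemannian metric $g_\beta$ on $B$ such that $\pi:(\mu^{-1}(\beta),i^*g_M)\to(B,g_\beta)$ is a Riemannian submersion and $\omega_\beta(X,Y)=g_\beta(J_\beta X,Y)$ for all $X,Y\in TB$ if and only if $\pi$ is an almost complex mapping to $(B,J_\beta)$. In particular, there exist an almost complex structure $J_\beta$ and a Riemannian metric $g_\beta$ on $B$ such that $\pi$ is a Riemannian submersion and $\omega_\beta=g_\beta(J_\beta\cdot,\cdot)$ if and only if there is an almost complex structure $J_\beta$ on $B$ for which $\pi$ is an almost complex mapping. -/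

import Mathlib

open scoped Manifold ContDiff
open Bundle

noncomputable section

namespace SymplecticReduction

section Tensors

variable {E : Type*} [NormedAddCommGroup E] [NormedSpace ℝ E]
  {N : Type*} [TopologicalSpace N] [ChartedSpace E N]
  {E' : Type*} [NormedAddCommGroup E'] [NormedSpace ℝ E']
  {N' : Type*} [TopologicalSpace N'] [ChartedSpace E' N']

variable (E N) in
/-- Fields of bilinear forms on the tangent spaces of `N` (no smoothness required). -/
abbrev BilinField : Type _ :=
  ∀ x : N, TangentSpace 𝓘(ℝ, E) x →L[ℝ] TangentSpace 𝓘(ℝ, E) x →L[ℝ] ℝ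

variable (E N) in
/-- Fields of endomorphisms of the tangent spaces of `N` (no smoothness required). -/
abbrev EndField : Type _ :=
  ∀ x : N, TangentSpace 𝓘(ℝ, E) x →L[ℝ] TangentSpace 𝓘(ℝ, E) x

variable (E N) in
/-- Smooth Riemannian metrics on the manifold `N`. -/
abbrev RiemMetric [IsManifold 𝓘(ℝ, E) ∞ N] : Type _ :=
  ContMDiffRiemannianMetric 𝓘(ℝ, E) ∞ E (fun x : N ↦ TangentSpace 𝓘(ℝ, E) x)

/-- The pull-back `f^* b` of a field of bilinear forms. -/
def pullback (f : N' → N) (b : BilinField E N) : BilinField E' N' :=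
  fun z ↦
    let B : E →L[ℝ] E →L[ℝ] ℝ := b (f z)
    let D : E' →L[ℝ] E := mfderiv 𝓘(ℝ, E') 𝓘(ℝ, E) f z
    let P : E' →L[ℝ] E' →L[ℝ] ℝ := B.bilinearComp D D
    P

lemma pullback_apply (f : N' → N) (b : BilinField E N) (z : N')
    (u v : TangentSpace 𝓘(ℝ, E') z) :
    pullback f b z u v =
      b (f z) (mfderiv 𝓘(ℝ, E') 𝓘(ℝ, E) f z u) (mfderiv 𝓘(ℝ, E') 𝓘(ℝ, E) f z v) := rfl

/-- The expression of a field of bilinear forms in the chart around `x₀`, as a function of the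
point `y` in the target of the chart and of two vectors of the model space. -/
def inChart (b : BilinField E N) (x₀ : N) (y v w : E) : ℝ :=
  pullback (extChartAt 𝓘(ℝ, E) x₀).symm b y v w

/-- Symplectic forms: smooth, alternating, non-degenerate and closed. Closedness is
`(dω)(u, v, w) = ∂_u ω(v, w) + ∂_v ω(w, u) + ∂_w ω(u, v) = 0` in the charts of the manifold, for
constant vectors `u, v, w`. -/
structure IsSymplecticForm [IsManifold 𝓘(ℝ, E) ∞ N] (ωM : BilinField E N) : Prop where
  smooth : ContMDiff 𝓘(ℝ, E) (𝓘(ℝ, E).prod 𝓘(ℝ, E →L[ℝ] E →L[ℝ] ℝ)) ∞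
    (fun x : N ↦ TotalSpace.mk' (E →L[ℝ] E →L[ℝ] ℝ)
      (E := fun x : N ↦ TangentSpace 𝓘(ℝ, E) x →L[ℝ] TangentSpace 𝓘(ℝ, E) x →L[ℝ] ℝ) x (ωM x))
  alternating : ∀ x u, ωM x u u = 0
  nondegenerate : ∀ x u, (∀ v, ωM x u v = 0) → u = 0
  closed : ∀ (x₀ : N), ∀ y ∈ (extChartAt 𝓘(ℝ, E) x₀).target, ∀ u v w : E,
    fderiv ℝ (fun y' ↦ inChart ωM x₀ y' v w) y u + fderiv ℝ (fun y' ↦ inChart ωM x₀ y' w u) y v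
      + fderiv ℝ (fun y' ↦ inChart ωM x₀ y' u v) y w = 0

/-- Smooth almost complex structures. -/
structure IsAlmostComplexStructure [IsManifold 𝓘(ℝ, E) ∞ N] (J : EndField E N) : Prop where
  smooth : ContMDiff 𝓘(ℝ, E) (𝓘(ℝ, E).prod 𝓘(ℝ, E →L[ℝ] E)) ∞
    (fun x : N ↦ TotalSpace.mk' (E →L[ℝ] E)
      (E := fun x : N ↦ TangentSpace 𝓘(ℝ, E) x →L[ℝ] TangentSpace 𝓘(ℝ, E) x) x (J x))
  sq_eq_neg : ∀ x u, J x (J x u) = -u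

/-- `ω = g(J ·, ·)`. -/
def IsCompatible (ωM : BilinField E N) (J : EndField E N) (g : BilinField E N) : Prop :=
  ∀ x u v, ωM x u v = g x (J x u) v

/-- `f` is a Riemannian submersion from `(N', g')` to `(N, g)`: it is smooth with surjective
differentials, and `df` preserves the inner products of horizontal vectors, that is, of vectors
that are `g'`-orthogonal to the kernel of `df`. -/
structure IsRiemannianSubmersion (f : N' → N) (g' : BilinField E' N') (g : BilinField E N) :
    Prop where
  smooth : ContMDiff 𝓘(ℝ, E') 𝓘(ℝ, E) ∞ f
  surjective : ∀ z, Function.Surjective (mfderiv 𝓘(ℝ, E') 𝓘(ℝ, E) f z)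
  isometry : ∀ z (u v : TangentSpace 𝓘(ℝ, E') z),
    (∀ k, mfderiv 𝓘(ℝ, E') 𝓘(ℝ, E) f z k = 0 → g' z u k = 0) →
    (∀ k, mfderiv 𝓘(ℝ, E') 𝓘(ℝ, E) f z k = 0 → g' z v k = 0) →
    g' z u v = g (f z) (mfderiv 𝓘(ℝ, E') 𝓘(ℝ, E) f z u) (mfderiv 𝓘(ℝ, E') 𝓘(ℝ, E) f z v)

/-- `df ∘ J' = J ∘ df`. -/
def IsAlmostComplexMap (f : N' → N) (J' : EndField E' N') (J : EndField E N) : Prop :=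
  ∀ z u, mfderiv 𝓘(ℝ, E') 𝓘(ℝ, E) f z (J' z u) = J (f z) (mfderiv 𝓘(ℝ, E') 𝓘(ℝ, E) f z u)

/-- `J'` is the endomorphism field that `J` induces on the submanifold `ι : N' → N` of the
Riemannian manifold `(N, g)`: `J' u` is the tangential part of `J u`, that is, `J u - J' u` is
orthogonal to the submanifold. If `J` preserves the tangent spaces of the submanifold, then `J'` is
the restriction of `J`. -/
def IsInducedEndField (ι : N' → N) (g : BilinField E N) (J : EndField E N)
    (J' : EndField E' N') : Prop :=
  ∀ z (u v : TangentSpace 𝓘(ℝ, E') z),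
    g (ι z) (J (ι z) (mfderiv 𝓘(ℝ, E') 𝓘(ℝ, E) ι z u)
        - mfderiv 𝓘(ℝ, E') 𝓘(ℝ, E) ι z (J' z u))
      (mfderiv 𝓘(ℝ, E') 𝓘(ℝ, E) ι z v) = 0

end Tensors

section Coadjoint

variable {EG : Type*} [NormedAddCommGroup EG] [NormedSpace ℝ EG]
  {G : Type*} [TopologicalSpace G] [ChartedSpace EG G] [Group G]

/-- The adjoint representation: `Ad g` is the differential of `h ↦ g h g⁻¹` at the identity. The
Lie algebra `T₁ G` is, by the definition of tangent spaces in Mathlib, the model space `EG`. -/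
def Ad (g : G) : EG →L[ℝ] EG :=
  mfderiv 𝓘(ℝ, EG) 𝓘(ℝ, EG) (fun h : G ↦ g * h * g⁻¹) (1 : G)

/-- The coadjoint action `β ↦ β ∘ Ad g⁻¹` on the dual of the Lie algebra. -/
def coAd (g : G) (β : EG →L[ℝ] ℝ) : EG →L[ℝ] ℝ := β.comp (Ad g⁻¹)

lemma Ad_one : Ad (1 : G) = ContinuousLinearMap.id ℝ EG := by
  have h : (fun h : G ↦ 1 * h * 1⁻¹) = id := by
    ext h
    simp
  unfold Ad
  rw [h]
  exact mfderiv_id (I := 𝓘(ℝ, EG)) (x := (1 : G))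

variable [LieGroup 𝓘(ℝ, EG) ∞ G]

lemma mdifferentiable_conj (g : G) :
    MDifferentiable 𝓘(ℝ, EG) 𝓘(ℝ, EG) (fun h : G ↦ g * h * g⁻¹) := by
  have h : ContMDiff 𝓘(ℝ, EG) 𝓘(ℝ, EG) ∞ (fun h : G ↦ g * h * g⁻¹) :=
    (contMDiff_mul_right (I := 𝓘(ℝ, EG)) (n := ∞) (a := g⁻¹)).comp
      (contMDiff_mul_left (I := 𝓘(ℝ, EG)) (n := ∞) (a := g))
  exact h.mdifferentiable (by simp)

lemma Ad_mul (g h : G) : Ad (g * h) = (Ad g).comp (Ad h : EG →L[ℝ] EG) := by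
  have e : (fun k : G ↦ (g * h) * k * (g * h)⁻¹)
      = (fun k : G ↦ g * k * g⁻¹) ∘ (fun k : G ↦ h * k * h⁻¹) := by
    ext k
    simp [mul_assoc]
  have h1 : h * 1 * h⁻¹ = (1 : G) := by simp
  have key : Ad (g * h) = ContinuousLinearMap.comp
      (show EG →L[ℝ] EG from
        mfderiv 𝓘(ℝ, EG) 𝓘(ℝ, EG) (fun k : G ↦ g * k * g⁻¹) (h * 1 * h⁻¹))
      (Ad h) := by
    unfold Ad
    rw [e]
    exact mfderiv_comp (1 : G) (mdifferentiable_conj g _) (mdifferentiable_conj h _)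
  rw [key, h1]
  rfl

/-- The isotropy subgroup `G_β` for the coadjoint action. -/
def isotropy (G : Type*) [TopologicalSpace G] [ChartedSpace EG G] [Group G]
    [LieGroup 𝓘(ℝ, EG) ∞ G] (β : EG →L[ℝ] ℝ) : Subgroup G where
  carrier := {g | coAd g β = β}
  one_mem' := by
    simp [coAd, Ad_one]
  mul_mem' := by
    intro a b ha hb
    simp only [Set.mem_ofPred_eq, coAd] at ha hb ⊢
    rw [mul_inv_rev, Ad_mul, ← ContinuousLinearMap.comp_assoc, hb, ha]
  inv_mem' := by
    intro a ha
    simp only [Set.mem_ofPred_eq, coAd] at ha ⊢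
    conv_lhs => rw [← ha]
    rw [ContinuousLinearMap.comp_assoc, ← Ad_mul]
    simp [Ad_one]

end Coadjoint

section Hamiltonian

variable {EM : Type*} [NormedAddCommGroup EM] [NormedSpace ℝ EM]
  {M : Type*} [TopologicalSpace M] [ChartedSpace EM M]
  {EG : Type*} [NormedAddCommGroup EG] [NormedSpace ℝ EG]
  {G : Type*} [TopologicalSpace G] [ChartedSpace EG G] [Group G] [MulAction G M]

variable (G) in
/-- The action preserves the field of bilinear forms `b`: for a symplectic form this says that the
action is symplectic, for a Riemannian metric that it is by isometries. -/
def IsInvariant (b : BilinField EM M) : Prop :=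
  ∀ (a : G) (x : M) (u v : TangentSpace 𝓘(ℝ, EM) x),
    b (a • x) (mfderiv 𝓘(ℝ, EM) 𝓘(ℝ, EM) (fun y : M ↦ a • y) x u)
      (mfderiv 𝓘(ℝ, EM) 𝓘(ℝ, EM) (fun y : M ↦ a • y) x v) = b x u v

variable (G) in
/-- The infinitesimal generator `ξ_M(x) = d/dt (exp (t ξ) • x)` at `t = 0`, that is, the image of
`ξ ∈ T₁ G` under the differential of `a ↦ a • x` at the identity. -/
def generator (ξ : EG) (x : M) : TangentSpace 𝓘(ℝ, EM) x :=
  (mfderiv 𝓘(ℝ, EG) 𝓘(ℝ, EM) (fun a : G ↦ a • x) (1 : G) : EG →L[ℝ] EM) ξ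

variable (G) in
/-- `μ` is a momentum map: it is smooth and `d⟨μ, ξ⟩ = ω(ξ_M, ·)` for all `ξ` in the Lie algebra. -/
structure IsMomentumMap (ωM : BilinField EM M) (μ : M → (EG →L[ℝ] ℝ)) : Prop where
  smooth : ContMDiff 𝓘(ℝ, EM) 𝓘(ℝ, EG →L[ℝ] ℝ) ∞ μ
  hamilton : ∀ (x : M) (ξ : EG) (v : TangentSpace 𝓘(ℝ, EM) x),
    NormedSpace.fromTangentSpace (μ x) (mfderiv 𝓘(ℝ, EM) 𝓘(ℝ, EG →L[ℝ] ℝ) μ x v) ξ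
       = ωM x (generator G ξ x) v

variable (G) in
/-- `Ad^*`-equivariance. -/
def IsEquivariant (μ : M → (EG →L[ℝ] ℝ)) : Prop :=
  ∀ (a : G) (x : M), μ (a • x) = coAd a (μ x)

variable [LieGroup 𝓘(ℝ, EG) ∞ G]

/-- The level set `μ⁻¹(β)`, with the action of `G_β`. -/
def level {μ : M → (EG →L[ℝ] ℝ)} (hμ : IsEquivariant G μ) (β : EG →L[ℝ] ℝ) :
    SubMulAction (isotropy G β) M where
  carrier := μ ⁻¹' {β}
  smul_mem' := by
    intro a x hx
    have hx' : μ x = β := hx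
    have ha : coAd (a : G) β = β := a.2
    change μ ((a : G) • x) = β
    rw [hμ, hx', ha]

/-- The inclusion `μ⁻¹(β) → M`. -/
def incl {μ : M → (EG →L[ℝ] ℝ)} (hμ : IsEquivariant G μ) (β : EG →L[ℝ] ℝ) :
    level hμ β → M := Subtype.val

/-- The reduced space `μ⁻¹(β) / G_β`, with the quotient topology. -/
abbrev Reduced {μ : M → (EG →L[ℝ] ℝ)} (hμ : IsEquivariant G μ) (β : EG →L[ℝ] ℝ) : Type _ :=
  MulAction.orbitRel.Quotient (isotropy G β) (level hμ β)

/-- The projection `π : μ⁻¹(β) → μ⁻¹(β) / G_β`. -/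
def proj {μ : M → (EG →L[ℝ] ℝ)} (hμ : IsEquivariant G μ) (β : EG →L[ℝ] ℝ) :
    level hμ β → Reduced hμ β := Quotient.mk _

end Hamiltonian

end SymplecticReduction

end
open SymplecticReduction

noncomputable section

/-! Write $i$ for the inclusion of the level set, $\pi$ for its projection and $\sigma = i^*\omega =
g(J'\cdot,\cdot)$ with $g = i^*g_M$.

The reduced form comes from $\ker\sigma = \ker d\pi$ (`differential_proj_eq_zero_iff`). The tangent
space of the level set is $\ker d\mu$; by $d\langle\mu,\xi\rangle = \omega(\xi_M,\cdot)$ and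
nondegeneracy its $\omega$-orthogonal consists of the generators $\xi_M$
(`exists_gen_of_orthogonal`). A generator tangent to the level set is the velocity of a curve in a
$G_\beta$-orbit (`exists_vertical_of_gen`); conversely, freeness and properness make each vertical
vector a generator (`exists_gen_of_vertical`). Being invariant as well, $\sigma$ descends to
$\omega_\beta$ (`exists_pullback_eq`). For a local section $s$ of $\pi$ one has $\omega_\beta =
(i\circ s)^*\omega$, which is smooth and closed (`isSymplecticForm_of_pullback_eq`).

The equivalence is linear algebra at each point. If $\pi$ is a Riemannian submersion, $J'u$ is
horizontal, and testing $d\pi(J'u)$ against horizontal lifts identifies it with $J_\beta\,d\pi(u)$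
(`comm_of_isometry`). Conversely the only candidate is $g_\beta =
-\omega_\beta(J_\beta\cdot,\cdot)$; if $\pi$ is almost complex, its pull-back is
$g(J'\cdot,J'\cdot)$, which is symmetric, positive on the quotient and equal to $g$ on horizontal
vectors (`metric_of_comm`). -/

namespace SymplecticReduction

/-! ### Local sections, retractions and curves from normal forms and the inverse function theorem.
-/

section LocalStructure

open Filter Topology

variable {E : Type*} [NormedAddCommGroup E] [NormedSpace ℝ E]
  {N : Type*} [TopologicalSpace N] [ChartedSpace E N]
  {E' : Type*} [NormedAddCommGroup E'] [NormedSpace ℝ E']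
  {N' : Type*} [TopologicalSpace N'] [ChartedSpace E' N']

/-- The differential of `f` at `x` as a linear map between the model spaces. -/
def differential (f : N' → N) (x : N') : E' →L[ℝ] E := mfderiv 𝓘(ℝ, E') 𝓘(ℝ, E) f x

/-- A submersion has smooth local sections through each point. -/
lemma exists_local_section {f : N' → N} {x : N'}
    (h : Manifold.IsSubmersionAt 𝓘(ℝ, E') 𝓘(ℝ, E) ∞ f x) :
    ∃ s : N → N', ContMDiffAt 𝓘(ℝ, E) 𝓘(ℝ, E') ∞ s (f x) ∧ s (f x) = x ∧
      ∀ᶠ y in 𝓝 (f x), f (s y) = y := by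
  set φ := h.domChart
  set ψ := h.codChart
  set e := h.equiv
  have hx : x ∈ φ.source := h.mem_domChart_source
  have hfx : f x ∈ ψ.source := h.mem_codChart_source
  have hw : ∀ y ∈ φ.target, ψ (f (φ.symm y)) = (e y).1 := fun y hy ↦ by
    have h1 : y ∈ (h.domChart.extend 𝓘(ℝ, E')).target := by simpa using hy
    simpa using h.writtenInCharts h1
  have hmap : ∀ y ∈ φ.source, f y ∈ ψ.source := fun y hy ↦ h.source_subset_preimage_source hy
  have hex : e.symm (ψ (f x), (e (φ x)).2) = φ x := by
    have := hw (φ x) (φ.map_source hx)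
    rw [φ.left_inv hx] at this
    rw [this, Prod.mk.eta, e.symm_apply_apply]
  have hψ : ContMDiffAt 𝓘(ℝ, E) 𝓘(ℝ, E) ∞ ψ (f x) :=
    contMDiffAt_of_mem_maximalAtlas h.codChart_mem_maximalAtlas hfx
  -- In the normal form `f` is the first projection; the section freezes the second coordinate at
  -- its value at `x`.
  have hq : ContMDiffAt 𝓘(ℝ, E) 𝓘(ℝ, E') ∞ (fun b ↦ e.symm (ψ b, (e (φ x)).2)) (f x) := by
    have h1 : ContDiff ℝ ∞ (fun u : E ↦ e.symm (u, (e (φ x)).2)) := by fun_prop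
    exact h1.contMDiff.contMDiffAt.comp (f x) hψ
  have hs : ContMDiffAt 𝓘(ℝ, E) 𝓘(ℝ, E') ∞ (fun b ↦ φ.symm (e.symm (ψ b, (e (φ x)).2))) (f x) := by
    refine ContMDiffAt.comp (f x) ?_ hq
    rw [hex]
    exact contMDiffAt_symm_of_mem_maximalAtlas h.domChart_mem_maximalAtlas (φ.map_source hx)
  refine ⟨_, hs, by simp only [hex]; exact φ.left_inv hx, ?_⟩
  have h1 : ∀ᶠ b in 𝓝 (f x), e.symm (ψ b, (e (φ x)).2) ∈ φ.target :=
    hq.continuousAt.eventually_mem (φ.open_target.mem_nhds (by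
      simp only [hex]; exact φ.map_source hx))
  filter_upwards [h1, ψ.open_source.mem_nhds hfx] with b hb hb'
  refine ψ.injOn (hmap _ (φ.map_target hb)) hb' ?_
  rw [hw _ hb]
  simp

/-- An immersion has smooth local retractions. -/
lemma exists_local_retraction {f : N' → N} {x : N'}
    (h : Manifold.IsImmersionAt 𝓘(ℝ, E') 𝓘(ℝ, E) ∞ f x) :
    ∃ r : N → N', ContMDiffAt 𝓘(ℝ, E) 𝓘(ℝ, E') ∞ r (f x) ∧ ∀ᶠ y in 𝓝 x, r (f y) = y := by
  set φ := h.domChart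
  set ψ := h.codChart
  set e := h.equiv
  have hx : x ∈ φ.source := h.mem_domChart_source
  have hfx : f x ∈ ψ.source := h.mem_codChart_source
  have hw : ∀ y ∈ φ.source, (e.symm (ψ (f y))).1 = φ y := fun y hy ↦ by
    have h0 : φ y ∈ (h.domChart.extend 𝓘(ℝ, E')).target := by simpa using φ.map_source hy
    have h1 : ψ (f (φ.symm (φ y))) = e (φ y, 0) := by simpa using h.writtenInCharts h0
    rw [φ.left_inv hy] at h1
    simp [h1]
  have hψ : ContMDiffAt 𝓘(ℝ, E) 𝓘(ℝ, E) ∞ ψ (f x) :=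
    contMDiffAt_of_mem_maximalAtlas h.codChart_mem_maximalAtlas hfx
  -- In the normal form `f` is `y ↦ (y, 0)`; the retraction forgets the second coordinate.
  have hq : ContMDiffAt 𝓘(ℝ, E) 𝓘(ℝ, E') ∞ (fun b ↦ (e.symm (ψ b)).1) (f x) := by
    have h1 : ContDiff ℝ ∞ (fun u : E ↦ (e.symm u).1) := by fun_prop
    exact h1.contMDiff.contMDiffAt.comp (f x) hψ
  refine ⟨fun b ↦ φ.symm (e.symm (ψ b)).1, ?_, ?_⟩
  · refine ContMDiffAt.comp (f x) ?_ hq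
    rw [hw x hx]
    exact contMDiffAt_symm_of_mem_maximalAtlas h.domChart_mem_maximalAtlas (φ.map_source hx)
  · filter_upwards [φ.open_source.mem_nhds hx] with y hy
    simp only [hw y hy]
    exact φ.left_inv hy

lemma contDiffAt_writtenInExtChartAt {f : N' → N} {x : N'}
    (hf : ContMDiffAt 𝓘(ℝ, E') 𝓘(ℝ, E) ∞ f x) :
    ContDiffAt ℝ ∞ (writtenInExtChartAt 𝓘(ℝ, E') 𝓘(ℝ, E) x f) (extChartAt 𝓘(ℝ, E') x x) := by
  have := (contMDiffAt_iff.1 hf).2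
  simpa [writtenInExtChartAt, contDiffWithinAt_univ] using this

lemma differential_eq_fderiv_written {f : N' → N} {x : N'}
    (hf : MDifferentiableAt 𝓘(ℝ, E') 𝓘(ℝ, E) f x) :
    (differential f x : E' →L[ℝ] E) =
      fderiv ℝ (writtenInExtChartAt 𝓘(ℝ, E') 𝓘(ℝ, E) x f) (extChartAt 𝓘(ℝ, E') x x) := by
  have h : HasFDerivWithinAt (writtenInExtChartAt 𝓘(ℝ, E') 𝓘(ℝ, E) x f)
      (differential f x : E' →L[ℝ] E) (Set.range 𝓘(ℝ, E'))
      (extChartAt 𝓘(ℝ, E') x x) := hf.hasMFDerivAt.2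
  rw [modelWithCornersSelf_coe, Set.range_id, hasFDerivWithinAt_univ] at h
  exact h.fderiv.symm

lemma differential_comp {E'' : Type*} [NormedAddCommGroup E''] [NormedSpace ℝ E'']
    {N'' : Type*} [TopologicalSpace N''] [ChartedSpace E'' N''] {f : N' → N} {h : N'' → N'} (x : N'')
    (hf : MDifferentiableAt 𝓘(ℝ, E') 𝓘(ℝ, E) f (h x))
    (hh : MDifferentiableAt 𝓘(ℝ, E'') 𝓘(ℝ, E') h x) :
    (differential (fun y ↦ f (h y)) x : E'' →L[ℝ] E) =
      (differential f (h x) : E' →L[ℝ] E).comp (differential h x : E'' →L[ℝ] E') :=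
  mfderiv_comp x hf hh

lemma differential_congr {f h : N' → N} {x : N'} (hfh : f =ᶠ[𝓝 x] h) :
    (differential f x : E' →L[ℝ] E) = differential h x :=
  hfh.mfderiv_eq

lemma differential_const (y : N) (x : N') :
    (differential (fun _ ↦ y) x : E' →L[ℝ] E) = 0 :=
  mfderiv_const

lemma differential_fun_id (x : N) :
    (differential (fun y : N ↦ y) x : E →L[ℝ] E) = ContinuousLinearMap.id ℝ E :=
  mfderiv_id

lemma differential_eq_fderiv (f : E' → E) (x : E') :
    (differential f x : E' →L[ℝ] E) = fderiv ℝ f x :=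
  mfderiv_eq_fderiv

/-- If the differential of `f` is surjective, then each vector in its kernel is the velocity of a
curve in a fibre of `f`. -/
lemma exists_curve_of_mem_ker [FiniteDimensional ℝ E] [FiniteDimensional ℝ E'] {f : N' → N} {x : N'}
    (hf : ContMDiffAt 𝓘(ℝ, E') 𝓘(ℝ, E) ∞ f x)
    (hsurj : Function.Surjective (differential f x : E' →L[ℝ] E)) (v : E')
    (hv : (differential f x : E' →L[ℝ] E) v = 0) :
    ∃ c : ℝ → N', c 0 = x ∧ MDifferentiableAt 𝓘(ℝ, ℝ) 𝓘(ℝ, E') c 0 ∧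
      (differential c 0 : ℝ →L[ℝ] E') 1 = v ∧ ∀ᶠ t in 𝓝 0, f (c t) = f x := by
  have : CompleteSpace E := FiniteDimensional.complete ℝ E
  have : CompleteSpace E' := FiniteDimensional.complete ℝ E'
  set φ := extChartAt 𝓘(ℝ, E') x
  set F := writtenInExtChartAt 𝓘(ℝ, E') 𝓘(ℝ, E) x f
  have hF : ContDiffAt ℝ ∞ F (φ x) := contDiffAt_writtenInExtChartAt hf
  have hd := differential_eq_fderiv_written (hf.mdifferentiableAt (by simp))
  have hs : HasStrictFDerivAt F (fderiv ℝ F (φ x)) (φ x) := hF.hasStrictFDerivAt (by simp)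
  have hr : (fderiv ℝ F (φ x)).range = ⊤ := by
    rw [← hd]
    exact LinearMap.range_eq_top.2 hsurj
  have hk : v ∈ (fderiv ℝ F (φ x)).ker := by
    rw [← hd]
    exact hv
  -- The implicit function parametrizes the level set of `F` by the kernel of its derivative, to
  -- first order by the inclusion of that kernel; the line spanned by `v` is sent to the curve
  -- sought.
  set c₀ : ℝ → E' := fun t ↦ hs.implicitFunction F _ hr (F (φ x)) (t • ⟨v, hk⟩)
  have hc0 : c₀ 0 = φ x := by
    simp only [c₀, zero_smul]
    exact hs.implicitFunction_apply_image hr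
  have hcd : HasDerivAt c₀ v 0 := by
    have h1 : HasDerivAt (fun t : ℝ ↦ t • (⟨v, hk⟩ : (fderiv ℝ F (φ x)).ker)) ⟨v, hk⟩ 0 := by
      simpa using (hasDerivAt_id (0 : ℝ)).smul_const (⟨v, hk⟩ : (fderiv ℝ F (φ x)).ker)
    have h2 := (hs.to_implicitFunction hr).hasFDerivAt
    rw [← zero_smul ℝ (⟨v, hk⟩ : (fderiv ℝ F (φ x)).ker)] at h2
    exact h2.comp_hasDerivAt (0 : ℝ) h1
  have hcF : ∀ᶠ t in 𝓝 0, F (c₀ t) = F (φ x) := by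
    have h1 : Tendsto (fun t : ℝ ↦ (F (φ x), t • (⟨v, hk⟩ : (fderiv ℝ F (φ x)).ker))) (𝓝 0)
        (𝓝 (F (φ x), 0)) := by
      refine tendsto_const_nhds.prodMk_nhds ?_
      have : Continuous fun t : ℝ ↦ t • (⟨v, hk⟩ : (fderiv ℝ F (φ x)).ker) := by fun_prop
      simpa using this.tendsto 0
    exact h1.eventually (hs.map_implicitFunction_eq hr)
  have htgt : ∀ᶠ t in 𝓝 0, c₀ t ∈ φ.target := by
    refine hcd.continuousAt.eventually_mem ?_
    rw [hc0]
    exact extChartAt_target_mem_nhds x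
  set c : ℝ → N' := fun t ↦ φ.symm (c₀ t)
  have hcx : c 0 = x := by simp [c, hc0, φ]
  have hcc : ContinuousAt c 0 := by
    refine ContinuousAt.comp (g := φ.symm) ?_ hcd.continuousAt
    rw [hc0]
    exact continuousAt_extChartAt_symm x
  have hM : HasMFDerivAt 𝓘(ℝ, ℝ) 𝓘(ℝ, E') c 0 (ContinuousLinearMap.toSpanSingleton ℝ v) := by
    refine ⟨hcc, ?_⟩
    have h1 : writtenInExtChartAt 𝓘(ℝ, ℝ) 𝓘(ℝ, E') 0 c =ᶠ[𝓝 0] c₀ := by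
      filter_upwards [htgt] with t ht
      simp only [writtenInExtChartAt, Function.comp_apply, hcx, extChartAt_model_space_eq_id]
      exact φ.right_inv ht
    have h2 := hcd.hasFDerivAt.congr_of_eventuallyEq h1
    simp only [extChartAt_model_space_eq_id]
    exact h2.hasFDerivWithinAt
  refine ⟨c, hcx, hM.mdifferentiableAt, ?_, ?_⟩
  · exact (DFunLike.congr_fun hM.mfderiv (1 : ℝ)).trans (one_smul ℝ v)
  -- The chart around `f x` is injective only on its source, so `f ∘ c` must first be kept there.
  · have h3 : ∀ᶠ t in 𝓝 0, f (c t) ∈ (extChartAt 𝓘(ℝ, E) (f x)).source := by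
      have h4 : ContinuousAt (f ∘ c) 0 := ContinuousAt.comp (by rw [hcx]; exact hf.continuousAt) hcc
      refine h4.eventually_mem ?_
      simp only [Function.comp_apply, hcx]
      exact extChartAt_source_mem_nhds (f x)
    filter_upwards [hcF, h3] with t ht ht'
    refine (extChartAt 𝓘(ℝ, E) (f x)).injOn ht' (mem_extChartAt_source _) ?_
    simpa [F, writtenInExtChartAt, c, φ] using ht

/-- A map with injective differential has local retractions. -/
lemma exists_local_retraction_of_injective [FiniteDimensional ℝ E] [FiniteDimensional ℝ E']
    [IsManifold 𝓘(ℝ, E) ∞ N] [IsManifold 𝓘(ℝ, E') ∞ N']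
    {f : N' → N} {x : N'} (hf : ContMDiffAt 𝓘(ℝ, E') 𝓘(ℝ, E) ∞ f x)
    (hinj : Function.Injective (differential f x : E' →L[ℝ] E)) :
    ∃ r : N → N', MDifferentiableAt 𝓘(ℝ, E) 𝓘(ℝ, E') r (f x) ∧ ∀ᶠ y in 𝓝 x, r (f y) = y := by
  have : CompleteSpace E := FiniteDimensional.complete ℝ E
  have : CompleteSpace E' := FiniteDimensional.complete ℝ E'
  set φ := extChartAt 𝓘(ℝ, E') x
  set ψ := extChartAt 𝓘(ℝ, E) (f x)
  set F := writtenInExtChartAt 𝓘(ℝ, E') 𝓘(ℝ, E) x f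
  have hF : ContDiffAt ℝ ∞ F (φ x) := contDiffAt_writtenInExtChartAt hf
  have hd := differential_eq_fderiv_written (hf.mdifferentiableAt (by simp))
  have hs : HasStrictFDerivAt F (fderiv ℝ F (φ x)) (φ x) := hF.hasStrictFDerivAt (by simp)
  obtain ⟨l, hl⟩ : ∃ l : E →ₗ[ℝ] E', l ∘ₗ (fderiv ℝ F (φ x)).toLinearMap = LinearMap.id :=
    LinearMap.exists_leftInverse_of_injective _ (by
      rw [← hd]
      exact LinearMap.ker_eq_bot.2 hinj)
  set l' : E →L[ℝ] E' := LinearMap.toContinuousLinearMap l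
  -- Composed with a linear left inverse of its derivative, `F` has derivative the identity. A local
  -- inverse `k` of `l' ∘ F` then gives the retraction `k ∘ l'`.
  have hG : HasStrictFDerivAt (fun y ↦ l' (F y))
      ((ContinuousLinearEquiv.refl ℝ E' : E' ≃L[ℝ] E') : E' →L[ℝ] E') (φ x) := by
    have h1 := l'.hasStrictFDerivAt.comp (φ x) hs
    have h2 : l'.comp (fderiv ℝ F (φ x)) = (ContinuousLinearEquiv.refl ℝ E' : E' →L[ℝ] E') := by
      ext v
      exact LinearMap.congr_fun hl v
    rw [h2] at h1
    exact h1
  set k := hG.localInverse _ _ _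
  have hk : HasFDerivAt k _ (l' (F (φ x))) := hG.to_localInverse.hasFDerivAt
  have hFx : F (φ x) = ψ (f x) := by simp [F, writtenInExtChartAt, φ, ψ]
  have hkx : k (l' (F (φ x))) = φ x := hG.localInverse_apply_image
  refine ⟨fun b ↦ φ.symm (k (l' (ψ b))), ?_, ?_⟩
  · have h1 : MDifferentiableAt 𝓘(ℝ, E) 𝓘(ℝ, E) ψ (f x) := mdifferentiableAt_extChartAt (by simp)
    have h2 : DifferentiableAt ℝ (fun u ↦ k (l' u)) (ψ (f x)) := by
      rw [← hFx]
      exact DifferentiableAt.comp (g := k) _ hk.differentiableAt l'.differentiableAt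
    have h3 := h2.mdifferentiableAt.comp (f x) h1
    refine MDifferentiableAt.comp (g := φ.symm) (f x) ?_ h3
    rw [← hFx, hkx]
    exact ((contMDiffOn_extChartAt_symm (I := 𝓘(ℝ, E')) (n := 1) x).contMDiffAt
      (extChartAt_target_mem_nhds x)).mdifferentiableAt (by simp)
  · have h1 := hG.eventually_left_inverse
    have h2 : ContinuousAt φ x := continuousAt_extChartAt x
    filter_upwards [h2.eventually h1, extChartAt_source_mem_nhds (I := 𝓘(ℝ, E')) x] with y hy hy'
    have h3 : F (φ y) = ψ (f y) := by
      simp only [F, writtenInExtChartAt, Function.comp_apply]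
      rw [(extChartAt 𝓘(ℝ, E') x).left_inv hy']
    rw [← h3]
    have : k (l' (F (φ y))) = φ y := hy
    rw [this]
    exact φ.left_inv hy'

end LocalStructure

/-! ### Bilinear forms in charts: smoothness, and naturality of the exterior derivative. -/

section TensorCalculus

open Filter Topology

variable {E : Type*} [NormedAddCommGroup E] [NormedSpace ℝ E]
  {N : Type*} [TopologicalSpace N] [ChartedSpace E N]
  {E' : Type*} [NormedAddCommGroup E'] [NormedSpace ℝ E']
  {N' : Type*} [TopologicalSpace N'] [ChartedSpace E' N']
  {E'' : Type*} [NormedAddCommGroup E''] [NormedSpace ℝ E'']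
  {N'' : Type*} [TopologicalSpace N''] [ChartedSpace E'' N'']

/-- The value of a field of bilinear forms, as a bilinear form on the model space. -/
def formAt (b : BilinField E N) (x : N) : E →L[ℝ] E →L[ℝ] ℝ := b x

lemma formAt_pullback (f : N' → N) (b : BilinField E N) (z : N') :
    formAt (E := E') (pullback f b) z =
      (formAt b (f z)).bilinearComp (differential f z) (differential f z) := rfl

lemma formAt_pullback_congr {f h : N' → N} {b b' : BilinField E N} {z : N'} (hfh : f =ᶠ[𝓝 z] h)
    (hb : formAt b (f z) = formAt b' (f z)) :
    formAt (E := E') (pullback f b) z = formAt (E := E') (pullback h b') z := by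
  rw [formAt_pullback, formAt_pullback, differential_congr hfh, hb, hfh.eq_of_nhds]

lemma formAt_pullback_comp {f : N' → N} {h : N'' → N'} (b : BilinField E N) {z : N''}
    (hf : MDifferentiableAt 𝓘(ℝ, E') 𝓘(ℝ, E) f (h z))
    (hh : MDifferentiableAt 𝓘(ℝ, E'') 𝓘(ℝ, E') h z) :
    formAt (E := E'') (pullback (fun y ↦ f (h y)) b) z =
      formAt (E := E'') (pullback h (pullback (E' := E') f b)) z := by
  rw [formAt_pullback, formAt_pullback, formAt_pullback, differential_comp z hf hh]
  rfl

/-- The expression of a field of bilinear forms in the chart around `x`. -/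
def chartForm (b : BilinField E N) (x : N) (y : E) : E →L[ℝ] E →L[ℝ] ℝ :=
  formAt (E := E) (pullback (extChartAt 𝓘(ℝ, E) x).symm b) y

/-- Smoothness of a field of bilinear forms at a point. -/
def IsSmoothFormAt [IsManifold 𝓘(ℝ, E) ∞ N] (b : BilinField E N) (x : N) : Prop :=
  ContMDiffAt 𝓘(ℝ, E) (𝓘(ℝ, E).prod 𝓘(ℝ, E →L[ℝ] E →L[ℝ] ℝ)) ∞
    (fun x : N ↦ TotalSpace.mk' (E →L[ℝ] E →L[ℝ] ℝ)
      (E := fun x : N ↦ TangentSpace 𝓘(ℝ, E) x →L[ℝ] TangentSpace 𝓘(ℝ, E) x →L[ℝ] ℝ) x (b x)) x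

/-- Smoothness of a field of endomorphisms at a point. -/
def IsSmoothEndAt [IsManifold 𝓘(ℝ, E) ∞ N] (J : EndField E N) (x : N) : Prop :=
  ContMDiffAt 𝓘(ℝ, E) (𝓘(ℝ, E).prod 𝓘(ℝ, E →L[ℝ] E)) ∞
    (fun x : N ↦ TotalSpace.mk' (E →L[ℝ] E)
      (E := fun x : N ↦ TangentSpace 𝓘(ℝ, E) x →L[ℝ] TangentSpace 𝓘(ℝ, E) x) x (J x)) x

lemma contMDiffAt_extChartAt_symm [IsManifold 𝓘(ℝ, E) ∞ N] {x : N} {y : E}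
    (hy : y ∈ (extChartAt 𝓘(ℝ, E) x).target) :
    ContMDiffAt 𝓘(ℝ, E) 𝓘(ℝ, E) ∞ (extChartAt 𝓘(ℝ, E) x).symm y :=
  (contMDiffOn_extChartAt_symm (I := 𝓘(ℝ, E)) (n := ∞) x).contMDiffAt
      ((isOpen_extChartAt_target x).mem_nhds hy)

lemma symmL_trivializationAt_eq_differential [IsManifold 𝓘(ℝ, E) ∞ N] {x y : N}
    (hy : y ∈ (chartAt E x).source) :
    @Eq (E →L[ℝ] E) ((trivializationAt E (TangentSpace 𝓘(ℝ, E)) x).symmL ℝ y)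
      (differential (extChartAt 𝓘(ℝ, E) x).symm (extChartAt 𝓘(ℝ, E) x y)) := by
  have h := TangentBundle.symmL_trivializationAt (I := 𝓘(ℝ, E)) hy
  rw [modelWithCornersSelf_coe, Set.range_id, mfderivWithin_univ] at h
  exact h

/-- The inverse of the tangent trivialization at `x` is the differential of the inverse chart, so
bundle coordinates are the same thing as pulling back by the inverse chart. -/
lemma inCoordinates_eq_chartForm [IsManifold 𝓘(ℝ, E) ∞ N] (b : BilinField E N) {x y : N}
    (hy : y ∈ (chartAt E x).source) :
    @Eq (E →L[ℝ] E →L[ℝ] ℝ)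
      (ContinuousLinearMap.inCoordinates E (TangentSpace 𝓘(ℝ, E)) (E →L[ℝ] ℝ)
        (fun x : N ↦ TangentSpace 𝓘(ℝ, E) x →L[ℝ] Trivial N ℝ x) x y x y (b y))
      (chartForm b x (extChartAt 𝓘(ℝ, E) x y)) := by
  have hb : y ∈ (trivializationAt E (TangentSpace 𝓘(ℝ, E)) x).baseSet := by
    simpa using hy
  ext v w
  refine (inCoordinates_apply_eq₂ (E₃ := Trivial N ℝ) hb hb (Set.mem_univ _)).trans ?_
  have hs : ∀ u : E, @Eq E ((trivializationAt E (TangentSpace 𝓘(ℝ, E)) x).symm y u)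
      ((differential (extChartAt 𝓘(ℝ, E) x).symm (extChartAt 𝓘(ℝ, E) x y) : E →L[ℝ] E) u) := by
    intro u
    rw [← symmL_trivializationAt_eq_differential hy]
    exact (Trivialization.symmL_apply _ hb u).symm
  have hy' : (extChartAt 𝓘(ℝ, E) x).symm (extChartAt 𝓘(ℝ, E) x y) = y :=
    (extChartAt 𝓘(ℝ, E) x).left_inv (by simpa using hy)
  refine (DFunLike.congr_fun (Trivial.linearMapAt_trivialization ℝ N ℝ y) _).trans ?_
  change formAt b y _ _ = formAt b _ _ _
  rw [hy', hs, hs]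
  rfl

/-- Translates smoothness of a section of the bundle into ordinary calculus on the model space,
where pull-backs are computed. -/
lemma isSmoothFormAt_iff [IsManifold 𝓘(ℝ, E) ∞ N] {b : BilinField E N} {x : N} :
    IsSmoothFormAt b x ↔ ContDiffAt ℝ ∞ (chartForm b x) (extChartAt 𝓘(ℝ, E) x x) := by
  have h1 : IsSmoothFormAt b x ↔ ContMDiffAt 𝓘(ℝ, E) 𝓘(ℝ, E →L[ℝ] E →L[ℝ] ℝ) ∞
      (fun y ↦ chartForm b x (extChartAt 𝓘(ℝ, E) x y)) x := by
    refine (contMDiffAt_hom_bundle (E₂ := fun x : N ↦ TangentSpace 𝓘(ℝ, E) x →L[ℝ] Trivial N ℝ x)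
      _).trans ?_
    refine (and_iff_right contMDiffAt_id).trans (Filter.EventuallyEq.contMDiffAt_iff ?_)
    filter_upwards [(chartAt E x).open_source.mem_nhds (mem_chart_source E x)] with y hy
    exact inCoordinates_eq_chartForm b hy
  rw [h1]
  constructor
  · intro h
    have h2 : ContMDiffAt 𝓘(ℝ, E) 𝓘(ℝ, E) ∞ (extChartAt 𝓘(ℝ, E) x).symm (extChartAt 𝓘(ℝ, E) x x) :=
      contMDiffAt_extChartAt_symm (mem_extChartAt_target x)
    have h3 := ContMDiffAt.comp (extChartAt 𝓘(ℝ, E) x x)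
      (by rw [extChartAt_to_inv]; exact h) h2
    refine (contMDiffAt_iff_contDiffAt.1 h3).congr_of_eventuallyEq ?_
    filter_upwards [extChartAt_target_mem_nhds (I := 𝓘(ℝ, E)) x] with y hy
    simp only [Function.comp_apply]
    rw [(extChartAt 𝓘(ℝ, E) x).right_inv hy]
  · intro h
    exact h.contMDiffAt.comp x contMDiffAt_extChartAt

/-- The relation `dω = 0` at a point of a chart. -/
def IsClosedAt (B : E → E →L[ℝ] E →L[ℝ] ℝ) (y : E) : Prop :=
  ∀ u v w : E, fderiv ℝ (fun y' ↦ B y' v w) y u + fderiv ℝ (fun y' ↦ B y' w u) y v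
      + fderiv ℝ (fun y' ↦ B y' u v) y w = 0

lemma contDiff_flip :
    ContDiff ℝ ∞ (fun L : E' →L[ℝ] E →L[ℝ] ℝ ↦ L.flip) := by
  refine IsBoundedLinearMap.contDiff ⟨⟨fun _ _ ↦ rfl, fun _ _ ↦ rfl⟩, 1, one_pos, fun L ↦ ?_⟩
  rw [one_mul, ContinuousLinearMap.opNorm_flip]

lemma contDiffAt_bilinearComp {B : E' → E →L[ℝ] E →L[ℝ] ℝ} {A : E' → E'' →L[ℝ] E} {y : E'}
    (hB : ContDiffAt ℝ ∞ B y) (hA : ContDiffAt ℝ ∞ A y) :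
    ContDiffAt ℝ ∞ (fun z ↦ (B z).bilinearComp (A z) (A z)) y := by
  have h1 := hB.clm_comp hA
  have h2 := contDiff_flip (E := E) (E' := E'')
  have h3 := contDiff_flip (E := E'') (E' := E'')
  exact h3.contDiffAt.comp y ((h2.contDiffAt.comp y h1).clm_comp hA)

-- The chain rule gives the pull-back of `dB` plus terms with the second derivative of `F`. These
-- cancel in pairs in the cyclic sum, because the second derivative is symmetric and `B` is skew.
set_option synthInstance.maxHeartbeats 200000 in
lemma IsClosedAt.bilinearComp {B : E → E →L[ℝ] E →L[ℝ] ℝ} {F : E' → E} {y : E'}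
    (hB : ContDiffAt ℝ ∞ B (F y)) (hF : ContDiffAt ℝ ∞ F y)
    (halt : ∀ u v, B (F y) u v = - B (F y) v u) (hc : IsClosedAt B (F y)) :
    IsClosedAt (fun z ↦ (B (F z)).bilinearComp (fderiv ℝ F z) (fderiv ℝ F z)) y := by
  have hB1 := (hB.differentiableAt (by simp)).hasFDerivAt
  have hF1 := (hF.differentiableAt (by simp)).hasFDerivAt
  have hA := hB1.comp y hF1
  have h1 : ContDiffAt ℝ ∞ (fderiv ℝ F) y := hF.fderiv_right (by simp)
  have hF2 := (h1.differentiableAt (by simp)).hasFDerivAt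
  have hsymm : ∀ u v, fderiv ℝ (fderiv ℝ F) y u v = fderiv ℝ (fderiv ℝ F) y v u := fun u v ↦
    (hF.isSymmSndFDerivAt (by rw [minSmoothness_of_isRCLikeNormedField]
                              exact WithTop.coe_le_coe.2 le_top)).eq u v
  have hd : ∀ u v w, fderiv ℝ (fun z ↦ (B (F z)).bilinearComp (fderiv ℝ F z) (fderiv ℝ F z) v w) y u
      = fderiv ℝ B (F y) (fderiv ℝ F y u) (fderiv ℝ F y v) (fderiv ℝ F y w)
        + B (F y) (fderiv ℝ (fderiv ℝ F) y u v) (fderiv ℝ F y w)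
        + B (F y) (fderiv ℝ F y v) (fderiv ℝ (fderiv ℝ F) y u w) := by
    intro u v w
    have hv := hF2.clm_apply (hasFDerivAt_const v y)
    have hw := hF2.clm_apply (hasFDerivAt_const w y)
    have h3 := (hA.clm_apply hv).clm_apply hw
    have h4 := congrArg (fun L ↦ L u) h3.fderiv
    simp only [Function.comp_apply] at h4
    simp only [ContinuousLinearMap.bilinearComp_apply]
    rw [h4]
    simp
    ring
  have hdB : ∀ u v w, fderiv ℝ (fun y' ↦ B y' v w) (F y) u = fderiv ℝ B (F y) u v w := by
    intro u v w
    have h3 := (hB1.clm_apply (hasFDerivAt_const v _)).clm_apply (hasFDerivAt_const w _)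
    rw [h3.fderiv]
    simp
  intro u v w
  rw [hd, hd, hd]
  have h5 := hc (fderiv ℝ F y u) (fderiv ℝ F y v) (fderiv ℝ F y w)
  rw [hdB, hdB, hdB] at h5
  rw [hsymm u v, hsymm v w, hsymm w u]
  have a1 := halt (fderiv ℝ (fderiv ℝ F) y v u) (fderiv ℝ F y w)
  have a2 := halt (fderiv ℝ (fderiv ℝ F) y w v) (fderiv ℝ F y u)
  have a3 := halt (fderiv ℝ (fderiv ℝ F) y u w) (fderiv ℝ F y v)
  linarith

end TensorCalculus

/-! ### Pull-backs of smooth and of closed forms between manifolds. -/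

section TensorPullback

open Filter Topology

variable {E : Type*} [NormedAddCommGroup E] [NormedSpace ℝ E]
  {N : Type*} [TopologicalSpace N] [ChartedSpace E N] [IsManifold 𝓘(ℝ, E) ∞ N]
  {E' : Type*} [NormedAddCommGroup E'] [NormedSpace ℝ E']
  {N' : Type*} [TopologicalSpace N'] [ChartedSpace E' N'] [IsManifold 𝓘(ℝ, E') ∞ N']

/-- A map read in the chart around `x` and in the chart around the image of `y`. -/
def mapInCharts (f : N' → N) (x : N') (y : E') : E' → E := fun z ↦
  extChartAt 𝓘(ℝ, E) (f ((extChartAt 𝓘(ℝ, E') x).symm y)) (f ((extChartAt 𝓘(ℝ, E') x).symm z))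

omit [IsManifold 𝓘(ℝ, E) ∞ N] in
lemma contDiffAt_mapInCharts {f : N' → N} {x : N'} {y : E'}
    (hy : y ∈ (extChartAt 𝓘(ℝ, E') x).target)
    (hf : ContMDiffAt 𝓘(ℝ, E') 𝓘(ℝ, E) ∞ f ((extChartAt 𝓘(ℝ, E') x).symm y)) :
    ContDiffAt ℝ ∞ (mapInCharts (E := E) f x y) y := by
  have h1 : ContMDiffAt 𝓘(ℝ, E') 𝓘(ℝ, E) ∞ (fun z ↦ f ((extChartAt 𝓘(ℝ, E') x).symm z)) y :=
    hf.comp y (contMDiffAt_extChartAt_symm hy)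
  exact ContMDiffAt.contDiffAt (ContMDiffAt.comp (I' := 𝓘(ℝ, E)) y contMDiffAt_extChartAt h1)

/-- Near `y` the map `f` read from the chart at `x` equals `ψ.symm ∘ F`, with `ψ` the chart at the
image point, so functoriality of pull-backs reduces the claim to `F` between model spaces. -/
lemma chartForm_pullback (b : BilinField E N) {f : N' → N} {x : N'} {y : E'}
    (hy : y ∈ (extChartAt 𝓘(ℝ, E') x).target)
    (hf : ContMDiffAt 𝓘(ℝ, E') 𝓘(ℝ, E) ∞ f ((extChartAt 𝓘(ℝ, E') x).symm y)) :
    ∀ᶠ z in 𝓝 y, chartForm (E := E') (pullback f b) x z =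
      (chartForm b (f ((extChartAt 𝓘(ℝ, E') x).symm y)) (mapInCharts (E := E) f x y z)).bilinearComp
        (fderiv ℝ (mapInCharts (E := E) f x y) z) (fderiv ℝ (mapInCharts (E := E) f x y) z) := by
  set φ := extChartAt 𝓘(ℝ, E') x
  set ψ := extChartAt 𝓘(ℝ, E) (f (φ.symm y))
  set F := mapInCharts (E := E) f x y
  have hφ : ContMDiffAt 𝓘(ℝ, E') 𝓘(ℝ, E') ∞ φ.symm y := contMDiffAt_extChartAt_symm hy
  have hfφ : ContMDiffAt 𝓘(ℝ, E') 𝓘(ℝ, E) ∞ (fun z ↦ f (φ.symm z)) y := hf.comp y hφ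
  have h1 : ∀ᶠ z in 𝓝 y, MDifferentiableAt 𝓘(ℝ, E') 𝓘(ℝ, E) f (φ.symm z) := by
    -- Being `C^1` at a point passes to a neighbourhood; for `C^∞` the neighbourhood may shrink with
    -- the order.
    have h2 : ContMDiffAt 𝓘(ℝ, E') 𝓘(ℝ, E) 1 f (φ.symm y) := hf.of_le (by simp)
    filter_upwards [hφ.continuousAt.eventually
      ((contMDiffAt_iff_contMDiffAt_nhds (by simp)).1 h2)] with z hz
    exact hz.mdifferentiableAt (by simp)
  have h2 : ∀ᶠ z in 𝓝 y, f (φ.symm z) ∈ ψ.source :=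
    hfφ.continuousAt.eventually_mem (extChartAt_source_mem_nhds _)
  filter_upwards [h1, h2.eventually_nhds, (isOpen_extChartAt_target x).mem_nhds hy] with z hz hz' hzt
  have hφz : MDifferentiableAt 𝓘(ℝ, E') 𝓘(ℝ, E') φ.symm z :=
    (contMDiffAt_extChartAt_symm hzt).mdifferentiableAt (by simp)
  have hF : MDifferentiableAt 𝓘(ℝ, E') 𝓘(ℝ, E) F z := by
    refine MDifferentiableAt.comp (I' := 𝓘(ℝ, E)) (g := ψ) z
      (mdifferentiableAt_extChartAt ?_) (hz.comp z hφz)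
    rw [← extChartAt_source 𝓘(ℝ, E)]
    exact hz'.self_of_nhds
  have hψ : MDifferentiableAt 𝓘(ℝ, E) 𝓘(ℝ, E) ψ.symm (F z) :=
    (contMDiffAt_extChartAt_symm (ψ.map_source hz'.self_of_nhds)).mdifferentiableAt (by simp)
  have hc : (fun z ↦ f (φ.symm z)) =ᶠ[𝓝 z] fun z ↦ ψ.symm (F z) := by
    filter_upwards [hz'] with w hw
    exact (ψ.left_inv hw).symm
  calc chartForm (E := E') (pullback f b) x z
      = formAt (E := E') (pullback (fun w ↦ f (φ.symm w)) b) z :=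
        (formAt_pullback_comp b hz hφz).symm
    _ = formAt (E := E') (pullback (fun w ↦ ψ.symm (F w)) b) z := formAt_pullback_congr hc rfl
    _ = formAt (E := E') (pullback F (pullback (E' := E) ψ.symm b)) z := formAt_pullback_comp b hψ hF
    _ = _ := by
      rw [formAt_pullback, differential_eq_fderiv]
      rfl

lemma IsSmoothFormAt.congr {b b' : BilinField E N} {x : N} (hb : IsSmoothFormAt b x)
    (h : ∀ᶠ y in 𝓝 x, formAt b' y = formAt b y) : IsSmoothFormAt b' x := by
  refine ContMDiffAt.congr_of_eventuallyEq hb ?_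
  filter_upwards [h] with y hy
  exact congrArg (TotalSpace.mk' (E →L[ℝ] E →L[ℝ] ℝ)
      (E := fun x : N ↦ TangentSpace 𝓘(ℝ, E) x →L[ℝ] TangentSpace 𝓘(ℝ, E) x →L[ℝ] ℝ) y) hy

lemma IsSmoothFormAt.pullback {b : BilinField E N} {f : N' → N} {x : N'}
    (hb : IsSmoothFormAt b (f x)) (hf : ContMDiffAt 𝓘(ℝ, E') 𝓘(ℝ, E) ∞ f x) :
    IsSmoothFormAt (E := E') (pullback f b) x := by
  have hx : (extChartAt 𝓘(ℝ, E') x).symm (extChartAt 𝓘(ℝ, E') x x) = x := extChartAt_to_inv x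
  have hy := mem_extChartAt_target (I := 𝓘(ℝ, E')) x
  rw [← hx] at hf
  have hF := contDiffAt_mapInCharts hy hf
  rw [isSmoothFormAt_iff]
  refine ContDiffAt.congr_of_eventuallyEq ?_ (chartForm_pullback b hy hf)
  refine contDiffAt_bilinearComp ?_ (hF.fderiv_right (by simp))
  refine ContDiffAt.comp _ ?_ hF
  simp only [mapInCharts]
  rw [hx]
  exact isSmoothFormAt_iff.1 hb

lemma chartForm_congr {b b' : BilinField E N} {x : N} {y : E}
    (hy : y ∈ (extChartAt 𝓘(ℝ, E) x).target)
    (h : ∀ᶠ z in 𝓝 ((extChartAt 𝓘(ℝ, E) x).symm y), formAt b' z = formAt b z) :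
    ∀ᶠ z in 𝓝 y, chartForm b' x z = chartForm b x z := by
  have h1 : ContinuousAt (extChartAt 𝓘(ℝ, E) x).symm y :=
    (contMDiffAt_extChartAt_symm hy).continuousAt
  filter_upwards [h1.eventually h] with z hz
  rw [chartForm, chartForm, formAt_pullback, formAt_pullback, hz]

lemma IsClosedAt.congr {B B' : E → E →L[ℝ] E →L[ℝ] ℝ} {y : E} (hB : IsClosedAt B y)
    (h : ∀ᶠ z in 𝓝 y, B' z = B z) : IsClosedAt B' y := by
  intro u v w
  have h1 : ∀ a c, (fun z ↦ B' z a c) =ᶠ[𝓝 y] fun z ↦ B z a c := by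
    intro a c
    filter_upwards [h] with z hz
    rw [hz]
  rw [(h1 v w).fderiv_eq, (h1 w u).fderiv_eq, (h1 u v).fderiv_eq]
  exact hB u v w

/-- The pull-back of a smooth closed form is closed. -/
lemma isClosedAt_chartForm_pullback {b : BilinField E N} {f : N' → N} {x : N'} {y : E'}
    (hy : y ∈ (extChartAt 𝓘(ℝ, E') x).target)
    (hf : ContMDiffAt 𝓘(ℝ, E') 𝓘(ℝ, E) ∞ f ((extChartAt 𝓘(ℝ, E') x).symm y))
    (hb : ∀ x, IsSmoothFormAt b x) (halt : ∀ x u, formAt b x u u = 0)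
    (hc : ∀ x, ∀ y ∈ (extChartAt 𝓘(ℝ, E) x).target, IsClosedAt (chartForm b x) y) :
    IsClosedAt (chartForm (E := E') (pullback f b) x) y := by
  have hF := contDiffAt_mapInCharts hy hf
  refine IsClosedAt.congr ?_ (chartForm_pullback b hy hf)
  refine IsClosedAt.bilinearComp (isSmoothFormAt_iff.1 (hb _)) hF ?_
    (hc _ _ (mem_extChartAt_target _))
  intro u v
  have h1 : ∀ p u v, formAt b p u v = - formAt b p v u := by
    intro p u v
    have h2 := halt p (u + v)
    simp only [map_add, _root_.add_apply, halt p u, halt p v] at h2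
    linarith
  exact h1 _ _ _

/-- The field of bilinear forms `(u, v) ↦ -b (J u, v)`. -/
def negComp (b : BilinField E N) (J : EndField E N) : BilinField E N := fun x ↦ -(b x).comp (J x)

lemma IsSmoothFormAt.negComp {b : BilinField E N} {J : EndField E N} {x : N}
    (hb : IsSmoothFormAt b x) (hJ : IsSmoothEndAt J x) : IsSmoothFormAt (negComp b J) x := by
  have h1 := ((contMDiffAt_hom_bundle (E₂ := fun x : N ↦ TangentSpace 𝓘(ℝ, E) x →L[ℝ] Trivial N ℝ x)
      _).1 hb).2
  have h2 := ((contMDiffAt_hom_bundle (E₂ := fun x : N ↦ TangentSpace 𝓘(ℝ, E) x) _).1 hJ).2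
  refine (contMDiffAt_hom_bundle (E₂ := fun x : N ↦ TangentSpace 𝓘(ℝ, E) x →L[ℝ] Trivial N ℝ x)
      _).2 ⟨contMDiffAt_id, ?_⟩
  have h3 := (h1.clm_comp h2).neg
  refine h3.congr_of_eventuallyEq ?_
  filter_upwards [(trivializationAt E (TangentSpace 𝓘(ℝ, E)) x).open_baseSet.mem_nhds
    (FiberBundle.mem_baseSet_trivializationAt' x)] with y hy
  ext v
  set T := trivializationAt E (TangentSpace 𝓘(ℝ, E)) x
  set A := (trivializationAt (E →L[ℝ] ℝ) (fun x : N ↦ TangentSpace 𝓘(ℝ, E) x →L[ℝ] Trivial N ℝ x)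
    x).continuousLinearMapAt ℝ y
  -- The trivialization and its inverse cancel between the two factors, so the coordinates of a
  -- composite are the composite of the coordinates.
  have h4 : T.symmL ℝ y (T.continuousLinearMapAt ℝ y (J y (T.symmL ℝ y v))) =
      J y (T.symmL ℝ y v) := T.symmL_continuousLinearMapAt hy _
  have h5 : A (-(b y (J y (T.symmL ℝ y v)))) =
      -A (b y (T.symmL ℝ y (T.continuousLinearMapAt ℝ y (J y (T.symmL ℝ y v))))) := by
    rw [h4, map_neg]
  exact DFunLike.congr_fun h5 _

end TensorPullback

/-! ### Pointwise linear algebra of the equivalence. -/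

section LinearAlgebra

variable {V : Type*} [NormedAddCommGroup V] [NormedSpace ℝ V] [FiniteDimensional ℝ V]
  {B : Type*} [NormedAddCommGroup B] [NormedSpace ℝ B]

/-- A definite bilinear form induces an isomorphism onto the dual space. -/
lemma bijective_of_definite {W : Type*} [AddCommGroup W] [Module ℝ W] [FiniteDimensional ℝ W]
    (g : W →ₗ[ℝ] Module.Dual ℝ W) (hpos : ∀ v, v ≠ 0 → 0 < g v v) : Function.Bijective g := by
  have hinj : Function.Injective g := by
    rw [← LinearMap.ker_eq_bot, LinearMap.ker_eq_bot']
    intro v hv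
    by_contra hne
    have := hpos v hne
    rw [hv] at this
    simp at this
  exact ⟨hinj, (LinearMap.injective_iff_surjective_of_finrank_eq_finrank
    Subspace.dual_finrank_eq.symm).1 hinj⟩

/-- A bilinear form as a linear map to the dual space. -/
def toDualMap (g : V →L[ℝ] V →L[ℝ] ℝ) : V →ₗ[ℝ] Module.Dual ℝ V :=
  (ContinuousLinearMap.coeLM ℝ).comp g.toLinearMap

/-- Riesz representation: `g` is invertible as a map to the dual, and `J` is its inverse applied to
`σ`. -/
lemma exists_endomorphism_of_definite (g σ : V →L[ℝ] V →L[ℝ] ℝ) (hpos : ∀ v, v ≠ 0 → 0 < g v v) :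
    ∃ J : V →L[ℝ] V, ∀ u v, g (J u) v = σ u v := by
  set e := LinearEquiv.ofBijective (toDualMap g) (bijective_of_definite (toDualMap g) hpos)
  refine ⟨LinearMap.toContinuousLinearMap (e.symm.toLinearMap ∘ₗ toDualMap σ), fun u v ↦ ?_⟩
  have h : e (e.symm (toDualMap σ u)) = toDualMap σ u := e.apply_symm_apply _
  exact LinearMap.congr_fun h v

/-- Since `g` is still definite on the kernel of `p`, any lift has an orthogonal projection to that
kernel, and subtracting it makes the lift horizontal. -/
lemma exists_horizontal_lift (g : V →L[ℝ] V →L[ℝ] ℝ) (hpos : ∀ v, v ≠ 0 → 0 < g v v)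
    (p : V →L[ℝ] B) (hp : Function.Surjective p) (Y : B) :
    ∃ v, p v = Y ∧ ∀ k, p k = 0 → g v k = 0 := by
  obtain ⟨v₀, hv₀⟩ := hp Y
  set K := p.toLinearMap.ker
  set gK : K →ₗ[ℝ] Module.Dual ℝ K := K.subtype.dualMap ∘ₗ toDualMap g ∘ₗ K.subtype
  have hK : ∀ k : K, k ≠ 0 → 0 < gK k k := fun k hk ↦ hpos k (by simpa using hk)
  obtain ⟨k₀, hk₀⟩ := (bijective_of_definite gK hK).2 (K.subtype.dualMap (toDualMap g v₀))
  refine ⟨v₀ - k₀, ?_, ?_⟩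
  · have : p k₀ = 0 := k₀.2
    rw [map_sub, this, hv₀, sub_zero]
  · intro k hk
    have h := LinearMap.congr_fun hk₀ ⟨k, hk⟩
    have h' : g k₀ k = g v₀ k := h
    rw [map_sub, _root_.sub_apply, h', sub_self]

/-- The pointwise content of the necessity of the almost complex condition. -/
lemma comm_of_isometry {σ g : V →L[ℝ] V →L[ℝ] ℝ} {p : V →L[ℝ] B} {J' : V →L[ℝ] V}
    {ωβ gβ : B →L[ℝ] B →L[ℝ] ℝ} {Jβ : B →L[ℝ] B}
    (hpos : ∀ v, v ≠ 0 → 0 < g v v) (hp : Function.Surjective p)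
    (hσ : ∀ u v, ωβ (p u) (p v) = σ u v) (hJ' : ∀ u v, g (J' u) v = σ u v)
    (hgβ : ∀ v, v ≠ 0 → 0 < gβ v v) (hcompat : ∀ X Y, ωβ X Y = gβ (Jβ X) Y)
    (hiso : ∀ u v, (∀ k, p k = 0 → g u k = 0) → (∀ k, p k = 0 → g v k = 0) →
      g u v = gβ (p u) (p v)) (u : V) : p (J' u) = Jβ (p u) := by
  have key : ∀ Y, gβ (p (J' u) - Jβ (p u)) Y = 0 := by
    intro Y
    obtain ⟨v, rfl, hv⟩ := exists_horizontal_lift g hpos p hp Y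
    -- `J' u` is always horizontal: for vertical `k`, `g (J' u) k = ωβ (p u) (p k) = 0`. Hence the
    -- isometry applies to `J' u` and the lift `v`.
    have hu : ∀ k, p k = 0 → g (J' u) k = 0 := by
      intro k hk
      rw [hJ', ← hσ, hk, map_zero]
    rw [map_sub, _root_.sub_apply, ← hiso _ _ hu hv, ← hcompat, hJ', hσ, sub_self]
  by_contra hne
  have h := hgβ _ (sub_ne_zero.2 hne)
  rw [key] at h
  exact lt_irrefl _ h

omit [FiniteDimensional ℝ V] in
/-- The pointwise content of the sufficiency of the almost complex condition. -/
lemma metric_of_comm {σ g : V →L[ℝ] V →L[ℝ] ℝ} {p : V →L[ℝ] B} {J' : V →L[ℝ] V}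
    {ωβ gβ : B →L[ℝ] B →L[ℝ] ℝ} {Jβ : B →L[ℝ] B}
    (hsymm : ∀ u v, g u v = g v u)
    (hpos : ∀ v, v ≠ 0 → 0 < g v v) (hp : Function.Surjective p)
    (hσ : ∀ u v, ωβ (p u) (p v) = σ u v) (hJ' : ∀ u v, g (J' u) v = σ u v)
    (halt : ∀ X, ωβ X X = 0) (hnd : ∀ X, (∀ Y, ωβ X Y = 0) → X = 0)
    (hsq : ∀ X, Jβ (Jβ X) = -X) (hcomm : ∀ u, p (J' u) = Jβ (p u))
    (hgβ : ∀ X Y, gβ X Y = -ωβ (Jβ X) Y) :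
    (∀ X Y, gβ X Y = gβ Y X) ∧ (∀ X, X ≠ 0 → 0 < gβ X X) ∧ (∀ X Y, ωβ X Y = gβ (Jβ X) Y) ∧
      (∀ u v, (∀ k, p k = 0 → g u k = 0) → (∀ k, p k = 0 → g v k = 0) →
        g u v = gβ (p u) (p v)) := by
  have hskew : ∀ X Y, ωβ X Y = -ωβ Y X := by
    intro X Y
    have h := halt (X + Y)
    simp only [map_add, _root_.add_apply, halt X, halt Y] at h
    linarith
  have hJskew : ∀ u v, g (J' u) v = -g u (J' v) := by
    intro u v
    rw [hJ', hsymm u (J' v), hJ', ← hσ, ← hσ]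
    exact hskew _ _
  -- Move `Jβ` through `p` as `J'`, pull `ωβ` back to `g (J' ·) ·`, and shift one `J'` to the other
  -- side by skewness.
  have hval : ∀ u v, gβ (p u) (p v) = g (J' u) (J' v) := by
    intro u v
    rw [hgβ, ← hcomm, hσ, ← hJ', hJskew (J' u) v, neg_neg]
  refine ⟨?_, ?_, ?_, ?_⟩
  · intro X Y
    obtain ⟨u, rfl⟩ := hp X
    obtain ⟨v, rfl⟩ := hp Y
    rw [hval, hval, hsymm]
  · intro X hX
    obtain ⟨u, rfl⟩ := hp X
    rw [hval]
    -- If `J' u = 0`, then `ωβ (p u)` vanishes identically, so `p u = 0` by nondegeneracy.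
    refine hpos _ fun h0 ↦ hX (hnd _ fun Y ↦ ?_)
    obtain ⟨v, rfl⟩ := hp Y
    rw [hσ, ← hJ', h0, map_zero, _root_.zero_apply]
  · intro X Y
    rw [hgβ, hsq, hskew (-X) Y, neg_neg, map_neg, ← hskew]
  · intro u v hu hv
    -- `J'` need not square to `-1`, but `J' (J' u) + u` is vertical, hence orthogonal to the
    -- horizontal vector `v`. So `g (J' u) (J' v) = g u v`.
    have h1 : p (J' (J' u) + u) = 0 := by
      rw [map_add, hcomm, hcomm, hsq, neg_add_cancel]
    have h2 := hv _ h1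
    rw [hsymm, map_add, _root_.add_apply, hJskew] at h2
    rw [hval]
    linarith

/-- The unit ball of a definite bilinear form is bounded. -/
lemma isVonNBounded_of_definite (q : V →L[ℝ] V →L[ℝ] ℝ) (hpos : ∀ v, v ≠ 0 → 0 < q v v) :
    Bornology.IsVonNBounded ℝ {v : V | q v v < 1} := by
  have hcont : Continuous fun v ↦ q v v := by fun_prop
  -- `c` is the minimum of the quadratic form on the compact unit sphere; the sphere is empty when
  -- `V` is trivial, and then any `c` serves.
  obtain ⟨c, hc, hcq⟩ : ∃ c : ℝ, 0 < c ∧ ∀ v, ‖v‖ = 1 → c ≤ q v v := by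
    rcases (Metric.sphere (0 : V) 1).eq_empty_or_nonempty with h | h
    · refine ⟨1, one_pos, fun v hv ↦ ?_⟩
      have : v ∈ Metric.sphere (0 : V) 1 := by simpa using hv
      rw [h] at this
      exact this.elim
    · obtain ⟨w, hw, hmin⟩ := (isCompact_sphere (0 : V) 1).exists_isMinOn h hcont.continuousOn
      have hw1 : ‖w‖ = 1 := by simpa using hw
      refine ⟨q w w, hpos w (norm_ne_zero_iff.1 (by rw [hw1]; exact one_ne_zero)), fun v hv ↦ ?_⟩
      exact hmin (by simpa using hv)
  rw [NormedSpace.isVonNBounded_iff, isBounded_iff_forall_norm_le]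
  -- From `‖v‖ ^ 2 ≤ c⁻¹` and `2 * ‖v‖ ≤ 1 + ‖v‖ ^ 2`; this bound avoids a square root.
  refine ⟨1 + c⁻¹, fun v hv ↦ ?_⟩
  have hv1 : q v v < 1 := hv
  rcases eq_or_ne v 0 with rfl | hne
  · rw [norm_zero]
    positivity
  · have hn : 0 < ‖v‖ := norm_pos_iff.2 hne
    have h1 := hcq (‖v‖⁻¹ • v) (by rw [norm_smul, norm_inv, norm_norm, inv_mul_cancel₀ hn.ne'])
    simp only [map_smul, _root_.smul_apply, smul_eq_mul] at h1
    have h2 : c * ‖v‖ ^ 2 ≤ q v v := by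
      have : c * ‖v‖ ^ 2 ≤ (‖v‖⁻¹ * (‖v‖⁻¹ * q v v)) * ‖v‖ ^ 2 := by gcongr
      calc c * ‖v‖ ^ 2 ≤ (‖v‖⁻¹ * (‖v‖⁻¹ * q v v)) * ‖v‖ ^ 2 := this
        _ = q v v := by field_simp
    have h3 : ‖v‖ ^ 2 ≤ c⁻¹ := by
      rw [← one_div, le_div_iff₀ hc]
      linarith
    nlinarith [sq_nonneg (‖v‖ - 1)]

end LinearAlgebra

/-! ### Velocities, lifting of curves to embedded submanifolds, descent of forms along a submersion.
-/

section Curves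

open Filter Topology

variable {E : Type*} [NormedAddCommGroup E] [NormedSpace ℝ E]
  {N : Type*} [TopologicalSpace N] [ChartedSpace E N]
  {E' : Type*} [NormedAddCommGroup E'] [NormedSpace ℝ E']
  {N' : Type*} [TopologicalSpace N'] [ChartedSpace E' N']

/-- The velocity of a curve. -/
def velocity (c : ℝ → N) (t : ℝ) : E := (differential c t : ℝ →L[ℝ] E) 1

lemma velocity_comp {f : N' → N} {c : ℝ → N'} {t : ℝ}
    (hf : MDifferentiableAt 𝓘(ℝ, E') 𝓘(ℝ, E) f (c t))
    (hc : MDifferentiableAt 𝓘(ℝ, ℝ) 𝓘(ℝ, E') c t) :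
    (velocity (fun t ↦ f (c t)) t : E) =
      (differential f (c t) : E' →L[ℝ] E) (velocity c t : E') := by
  rw [velocity, differential_comp t hf hc]
  rfl

lemma velocity_congr {c d : ℝ → N} {t : ℝ} (h : c =ᶠ[𝓝 t] d) :
    (velocity c t : E) = velocity d t := by
  rw [velocity, velocity, differential_congr h]

lemma velocity_const (x : N) (t : ℝ) : (velocity (fun _ : ℝ ↦ x) t : E) = 0 := by
  rw [velocity, differential_const]
  rfl

lemma injective_differential_of_isImmersionAt {f : N' → N} {x : N'}
    (h : Manifold.IsImmersionAt 𝓘(ℝ, E') 𝓘(ℝ, E) ∞ f x) :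
    Function.Injective (differential f x : E' →L[ℝ] E) := by
  obtain ⟨r, hr, hrf⟩ := exists_local_retraction h
  have h1 := differential_comp x (hr.mdifferentiableAt (by simp))
    (h.contMDiffAt.mdifferentiableAt (by simp))
  rw [differential_congr (h := fun y ↦ y) hrf, differential_fun_id] at h1
  exact Function.LeftInverse.injective fun u ↦ (DFunLike.congr_fun h1 u).symm

lemma surjective_differential_of_isSubmersionAt {f : N' → N} {x : N'}
    (h : Manifold.IsSubmersionAt 𝓘(ℝ, E') 𝓘(ℝ, E) ∞ f x) :
    Function.Surjective (differential f x : E' →L[ℝ] E) := by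
  obtain ⟨s, hs, hsx, hfs⟩ := exists_local_section h
  have h2 : MDifferentiableAt 𝓘(ℝ, E') 𝓘(ℝ, E) f (s (f x)) := by
    rw [hsx]
    exact h.contMDiffAt.mdifferentiableAt (by simp)
  have h1 := differential_comp (f x) h2 (hs.mdifferentiableAt (by simp))
  rw [differential_congr (h := fun y ↦ y) hfs, differential_fun_id, hsx] at h1
  exact Function.RightInverse.surjective fun u ↦ (DFunLike.congr_fun h1 u).symm

/-- Curves with values in an embedded submanifold are differentiable as curves in the
submanifold. -/
lemma exists_lift_curve {f : N' → N} (hf : Manifold.IsSmoothEmbedding 𝓘(ℝ, E') 𝓘(ℝ, E) ∞ f)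
    {c : ℝ → N} {x : N'} (hc : MDifferentiableAt 𝓘(ℝ, ℝ) 𝓘(ℝ, E) c 0) (hc0 : c 0 = f x)
    (hrange : ∀ᶠ t in 𝓝 0, c t ∈ Set.range f) :
    ∃ d : ℝ → N', d 0 = x ∧ MDifferentiableAt 𝓘(ℝ, ℝ) 𝓘(ℝ, E') d 0 ∧
      ∀ᶠ t in 𝓝 0, f (d t) = c t := by
  classical
  have hinj : Function.Injective f := hf.isEmbedding.injective
  have hch : ∀ t, ∃ y, c t ∈ Set.range f → f y = c t := fun t ↦ by
    by_cases h : c t ∈ Set.range f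
    · obtain ⟨y, hy⟩ := h
      exact ⟨y, fun _ ↦ hy⟩
    · exact ⟨x, fun h' ↦ (h h').elim⟩
  choose d hd using hch
  have hfd : ∀ᶠ t in 𝓝 0, f (d t) = c t := hrange.mono fun t ht ↦ hd t ht
  have hd0 : d 0 = x := hinj (by rw [hd 0 ⟨x, hc0.symm⟩, hc0])
  obtain ⟨r, hr, hrf⟩ := exists_local_retraction (hf.isImmersion.isImmersionAt x)
  -- Continuity of the lift uses the embedded topology. It keeps `d` where `r ∘ f` is the identity,
  -- so that `d = r ∘ c` near `0` is differentiable.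
  have hdc : ContinuousAt d 0 := by
    rw [hf.isEmbedding.isInducing.continuousAt_iff]
    exact hc.continuousAt.congr (hfd.mono fun t ht ↦ ht.symm)
  refine ⟨d, hd0, ?_, hfd⟩
  have h1 : MDifferentiableAt 𝓘(ℝ, ℝ) 𝓘(ℝ, E') (fun t ↦ r (c t)) 0 := by
    refine MDifferentiableAt.comp (I' := 𝓘(ℝ, E)) (g := r) 0 ?_ hc
    rw [hc0]
    exact hr.mdifferentiableAt (by simp)
  refine h1.congr_of_eventuallyEq ?_
  have h2 : ∀ᶠ t in 𝓝 0, r (f (d t)) = d t := by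
    refine hdc.eventually (p := fun y ↦ r (f y) = y) ?_
    rw [hd0]
    exact hrf
  filter_upwards [h2, hfd] with t ht ht'
  rw [← ht', ht]

/-- A form that vanishes on the kernels of `df` and is compatible with the fibres of `f` descends
to the base of the submersion. -/
lemma exists_pullback_eq [FiniteDimensional ℝ E] [FiniteDimensional ℝ E'] {f : N' → N}
    (hsurj : Function.Surjective f)
    (hd : ∀ z, Function.Surjective (differential f z : E' →L[ℝ] E)) (σ : BilinField E' N')
    (hker : ∀ z, ∀ k : E', (differential f z : E' →L[ℝ] E) k = 0 →
      ∀ u, formAt σ z k u = 0 ∧ formAt σ z u k = 0)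
    (hinv : ∀ z z', f z = f z' → ∃ T : E' →L[ℝ] E',
      (differential f z' : E' →L[ℝ] E).comp T = differential f z ∧
      ∀ u v, formAt σ z' (T u) (T v) = formAt σ z u v) :
    ∃ b : BilinField E N, pullback (E' := E') f b = σ := by
  choose s hs using hsurj
  have hR : ∀ z, ∃ R : E →L[ℝ] E', ∀ u, (differential f z : E' →L[ℝ] E) (R u) = u := fun z ↦ by
    obtain ⟨R, hR⟩ := (differential f z : E' →L[ℝ] E).toLinearMap.exists_rightInverse_of_surjective
      (LinearMap.range_eq_top.2 (hd z))
    exact ⟨LinearMap.toContinuousLinearMap R, fun u ↦ LinearMap.congr_fun hR u⟩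
  choose R hR using hR
  -- Evaluate `σ` at an arbitrary point `s y` of the fibre on linear lifts `R`. No regularity of `s`
  -- is needed: `hker` removes the dependence on the lift, `hinv` the dependence on the point.
  set b : BilinField E N := fun y ↦
    (((formAt σ (s y)).bilinearComp (R (s y)) (R (s y)) : E →L[ℝ] E →L[ℝ] ℝ))
  refine ⟨b, ?_⟩
  have key : ∀ z u v, formAt (E := E') (pullback f b) z u v = formAt σ z u v := by
    intro z u v
    obtain ⟨T, hT, hTσ⟩ := hinv z (s (f z)) (hs (f z)).symm
    have h1 : ∀ u : E', ∃ k : E', (differential f (s (f z)) : E' →L[ℝ] E) k = 0 ∧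
        R (s (f z)) ((differential f z : E' →L[ℝ] E) u) = T u + k := by
      intro u
      refine ⟨R (s (f z)) ((differential f z : E' →L[ℝ] E) u) - T u, ?_, by abel⟩
      rw [map_sub, hR, ← hT]
      exact sub_self _
    obtain ⟨k, hk, hku⟩ := h1 u
    obtain ⟨l, hl, hlv⟩ := h1 v
    change formAt σ (s (f z)) (R (s (f z)) ((differential f z : E' →L[ℝ] E) u))
      (R (s (f z)) ((differential f z : E' →L[ℝ] E) v)) = _
    rw [hku, hlv, map_add, (hker _ l hl _).2, add_zero, map_add, _root_.add_apply,
      (hker _ k hk _).1, add_zero, hTσ]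
  funext z
  exact ContinuousLinearMap.ext fun u ↦ ContinuousLinearMap.ext fun v ↦ key z u v

end Curves

/-! ### Orbit curves along left-invariant fields, and equivariance of the momentum map. -/

section GroupAction

open Filter Topology

variable {EM : Type*} [NormedAddCommGroup EM] [NormedSpace ℝ EM]
  {M : Type*} [TopologicalSpace M] [ChartedSpace EM M]
  {EG : Type*} [NormedAddCommGroup EG] [NormedSpace ℝ EG]
  {G : Type*} [TopologicalSpace G] [ChartedSpace EG G] [Group G]
  [MulAction G M] [ContMDiffSMul 𝓘(ℝ, EG) 𝓘(ℝ, EM) ∞ G M]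

lemma contMDiff_orbit (x : M) : ContMDiff 𝓘(ℝ, EG) 𝓘(ℝ, EM) ∞ (fun a : G ↦ a • x) :=
  contMDiff_id.smul contMDiff_const

/-- The infinitesimal generators as vectors of the model space. -/
def gen (G : Type*) [TopologicalSpace G] [ChartedSpace EG G] [Group G] [MulAction G M]
    (ξ : EG) (x : M) : EM :=
  (differential (fun a : G ↦ a • x) (1 : G) : EG →L[ℝ] EM) ξ

variable [LieGroup 𝓘(ℝ, EG) ∞ G]

/-- The differential of an orbit map, in terms of the generators. -/
lemma differential_orbit (x : M) (a : G) (ξ : EG) :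
    (differential (fun b : G ↦ b • x) a : EG →L[ℝ] EM)
        ((differential (fun h : G ↦ a * h) (1 : G) : EG →L[ℝ] EG) ξ) =
      (differential (fun y : M ↦ a • y) x : EM →L[ℝ] EM) (gen G ξ x) := by
  have ho : ∀ b : G, MDifferentiableAt 𝓘(ℝ, EG) 𝓘(ℝ, EM) (fun b : G ↦ b • x) b := fun b ↦
    ((contMDiff_orbit x) b).mdifferentiableAt (by simp)
  have hl : MDifferentiableAt 𝓘(ℝ, EG) 𝓘(ℝ, EG) (fun h : G ↦ a * h) (1 : G) :=
    ((contMDiff_mul_left (I := 𝓘(ℝ, EG)) (n := ∞) (a := a)) 1).mdifferentiableAt (by simp)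
  have ha : ∀ y, MDifferentiableAt 𝓘(ℝ, EM) 𝓘(ℝ, EM) (fun y : M ↦ a • y) y := fun y ↦
    ((ContMDiffSMul.contMDiff_const_smul (I := 𝓘(ℝ, EG)) (n := ∞) a) y).mdifferentiableAt (by simp)
  have h1 := differential_comp (1 : G) (ho (a * 1)) hl
  have h2 := differential_comp (1 : G) (ha ((1 : G) • x)) (ho 1)
  have h3 : (fun h : G ↦ (a * h) • x) = fun h ↦ a • h • x := by
    funext h
    exact mul_smul a h x
  rw [h3, h2, one_smul, mul_one] at h1
  exact (DFunLike.congr_fun h1 ξ).symm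

/-- Integral curves of the left-invariant vector fields, through the identity. -/
lemma exists_curve_of_mulInvariantVectorField [FiniteDimensional ℝ EG] (ξ : EG) :
    ∃ γ : ℝ → G, γ 0 = 1 ∧ ∀ᶠ t in 𝓝 0, MDifferentiableAt 𝓘(ℝ, ℝ) 𝓘(ℝ, EG) γ t ∧
      (velocity γ t : EG) = (differential (fun h : G ↦ γ t * h) (1 : G) : EG →L[ℝ] EG) ξ := by
  have : CompleteSpace EG := FiniteDimensional.complete ℝ EG
  have h3 : minSmoothness ℝ 3 ≤ (∞ : WithTop ℕ∞) := by
    rw [minSmoothness_of_isRCLikeNormedField]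
    exact WithTop.coe_le_coe.2 le_top
  have : LieGroup 𝓘(ℝ, EG) (minSmoothness ℝ 3) G := LieGroup.of_le h3
  have hv := (contMDiffAt_mulInvariantVectorField (I := 𝓘(ℝ, EG)) (G := G) ξ (g := 1)).of_le
    (m := 1) (by rw [minSmoothness_of_isRCLikeNormedField]; exact WithTop.coe_le_coe.2 (by simp))
  have : IsManifold 𝓘(ℝ, EG) 1 G := IsManifold.of_le (n := ∞) (by simp)
  -- A local integral curve through the identity plays the part of `t ↦ exp (t ξ)`.
  obtain ⟨γ, hγ0, hγ⟩ := exists_isMIntegralCurveAt_of_contMDiffAt_boundaryless (0 : ℝ) hv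
  refine ⟨γ, hγ0, hγ.mono fun t ht ↦ ⟨ht.mdifferentiableAt, ?_⟩⟩
  exact (DFunLike.congr_fun ht.mfderiv (1 : ℝ)).trans (one_smul ℝ _)

/-- The velocity of the orbit of `x` along such a curve. -/
lemma velocity_orbit (x : M) {γ : ℝ → G} {t : ℝ} {ξ : EG}
    (hγ : MDifferentiableAt 𝓘(ℝ, ℝ) 𝓘(ℝ, EG) γ t)
    (hv : (velocity γ t : EG) = (differential (fun h : G ↦ γ t * h) (1 : G) : EG →L[ℝ] EG) ξ) :
    (velocity (fun t ↦ γ t • x) t : EM) =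
      (differential (fun y : M ↦ γ t • y) x : EM →L[ℝ] EM) (gen G ξ x) := by
  rw [← differential_orbit, ← hv]
  exact velocity_comp (((contMDiff_orbit x) _).mdifferentiableAt (by simp)) hγ

variable [FiniteDimensional ℝ EG]

omit [LieGroup 𝓘(ℝ, EG) ∞ G] in
/-- The differential of an equivariant map intertwines the actions. -/
lemma differential_equivariant {μ : M → (EG →L[ℝ] ℝ)} (hμ : IsEquivariant G μ)
    (hs : ContMDiff 𝓘(ℝ, EM) 𝓘(ℝ, EG →L[ℝ] ℝ) ∞ μ) (a : G) (x : M) (v : EM)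
    (hv : (differential μ x : EM →L[ℝ] (EG →L[ℝ] ℝ)) v = 0) :
    (differential μ (a • x) : EM →L[ℝ] (EG →L[ℝ] ℝ))
      ((differential (fun y : M ↦ a • y) x : EM →L[ℝ] EM) v) = 0 := by
  set L : (EG →L[ℝ] ℝ) →ₗ[ℝ] (EG →L[ℝ] ℝ) :=
    { toFun := coAd a
      map_add' := fun _ _ ↦ rfl
      map_smul' := fun _ _ ↦ rfl }
  have hL : ∀ β, MDifferentiableAt 𝓘(ℝ, EG →L[ℝ] ℝ) 𝓘(ℝ, EG →L[ℝ] ℝ) (coAd a) β := fun β ↦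
    (LinearMap.toContinuousLinearMap L).differentiableAt.mdifferentiableAt
  have h1 := differential_comp x ((hs (a • x)).mdifferentiableAt (by simp))
    (((ContMDiffSMul.contMDiff_const_smul (I := 𝓘(ℝ, EG)) (n := ∞) a) x).mdifferentiableAt (by simp))
  have h2 := differential_comp x (hL (μ x)) ((hs x).mdifferentiableAt (by simp))
  have h3 : (fun y ↦ μ (a • y)) = fun y ↦ coAd a (μ y) := funext fun y ↦ hμ a y
  rw [h3, h2] at h1
  have h4 := DFunLike.congr_fun h1 v
  rw [ContinuousLinearMap.comp_apply, ContinuousLinearMap.comp_apply, hv, map_zero] at h4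
  exact h4.symm

/-- If a generator is tangent to a level set of `μ`, then the orbit along the corresponding curve
stays in the level set. -/
lemma eventually_map_orbit_eq {μ : M → (EG →L[ℝ] ℝ)} (hμ : IsEquivariant G μ)
    (hs : ContMDiff 𝓘(ℝ, EM) 𝓘(ℝ, EG →L[ℝ] ℝ) ∞ μ) (x : M) {ξ : EG}
    (hξ : (differential μ x : EM →L[ℝ] (EG →L[ℝ] ℝ)) (gen G ξ x) = 0) {γ : ℝ → G} (hγ0 : γ 0 = 1)
    (hγ : ∀ᶠ t in 𝓝 0, MDifferentiableAt 𝓘(ℝ, ℝ) 𝓘(ℝ, EG) γ t ∧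
      (velocity γ t : EG) = (differential (fun h : G ↦ γ t * h) (1 : G) : EG →L[ℝ] EG) ξ) :
    ∀ᶠ t in 𝓝 0, μ (γ t • x) = μ x := by
  obtain ⟨ε, hε, hball⟩ := Metric.eventually_nhds_iff_ball.1 hγ
  have hd : ∀ t ∈ Metric.ball (0 : ℝ) ε, HasDerivAt (fun t ↦ μ (γ t • x)) 0 t := by
    intro t ht
    obtain ⟨h1, h2⟩ := hball t ht
    have ho : MDifferentiableAt 𝓘(ℝ, ℝ) 𝓘(ℝ, EM) (fun t ↦ γ t • x) t :=
      MDifferentiableAt.comp (g := fun a : G ↦ a • x) t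
        (((contMDiff_orbit x) _).mdifferentiableAt (by simp)) h1
    have hm := (hs (γ t • x)).mdifferentiableAt (by simp)
    -- As the field is left-invariant, the orbit has velocity `γ t` applied to the generator at `x`.
    -- Equivariance carries its vanishing under `dμ` from `x` to `γ t • x`.
    have h3 : (velocity (fun t ↦ μ (γ t • x)) t : EG →L[ℝ] ℝ) = 0 := by
      rw [velocity_comp hm ho, velocity_orbit x h1 h2]
      exact differential_equivariant hμ hs (γ t) x _ hξ
    have h4 : DifferentiableAt ℝ (fun t ↦ μ (γ t • x)) t :=
      mdifferentiableAt_iff_differentiableAt.1 (hm.comp t ho)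
    rw [velocity, differential_eq_fderiv] at h3
    have h5 := h4.hasDerivAt
    rwa [← fderiv_apply_one_eq_deriv, h3] at h5
  filter_upwards [Metric.ball_mem_nhds (0 : ℝ) hε] with t ht
  have h6 := (convex_ball (0 : ℝ) ε).is_const_of_fderivWithin_eq_zero (𝕜 := ℝ)
    (f := fun t ↦ μ (γ t • x)) (fun t ht ↦ (hd t ht).differentiableAt.differentiableWithinAt)
    (fun t ht ↦ by
      rw [fderivWithin_of_isOpen Metric.isOpen_ball ht]
      ext1
      rw [fderiv_apply_one_eq_deriv, (hd t ht).deriv]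
      rfl) ht (Metric.mem_ball_self hε)
  simpa [hγ0] using h6

end GroupAction

/-! ### Tangent spaces of the level set, generators and vertical vectors. -/

section Level

open Filter Topology

variable {EM : Type*} [NormedAddCommGroup EM] [NormedSpace ℝ EM] [FiniteDimensional ℝ EM]
  {M : Type*} [TopologicalSpace M] [ChartedSpace EM M] [IsManifold 𝓘(ℝ, EM) ∞ M]
  {EG : Type*} [NormedAddCommGroup EG] [NormedSpace ℝ EG] [FiniteDimensional ℝ EG]
  {G : Type*} [TopologicalSpace G] [ChartedSpace EG G] [Group G] [LieGroup 𝓘(ℝ, EG) ∞ G]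
  [MulAction G M] [ContMDiffSMul 𝓘(ℝ, EG) 𝓘(ℝ, EM) ∞ G M]
  {ωM : BilinField EM M} {μ : M → (EG →L[ℝ] ℝ)}

omit [FiniteDimensional ℝ EM] [IsManifold 𝓘(ℝ, EM) ∞ M] [FiniteDimensional ℝ EG]
  [LieGroup 𝓘(ℝ, EG) ∞ G] [ContMDiffSMul 𝓘(ℝ, EG) 𝓘(ℝ, EM) ∞ G M] in
lemma hamilton (hmom : IsMomentumMap G ωM μ) (x : M) (ξ : EG) (v : EM) :
    (differential μ x : EM →L[ℝ] (EG →L[ℝ] ℝ)) v ξ = formAt ωM x (gen G ξ x) v :=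
  hmom.hamilton x ξ v

omit [FiniteDimensional ℝ EM] [IsManifold 𝓘(ℝ, EM) ∞ M] [FiniteDimensional ℝ EG]
  [LieGroup 𝓘(ℝ, EG) ∞ G] [ContMDiffSMul 𝓘(ℝ, EG) 𝓘(ℝ, EM) ∞ G M] in
/-- At regular points of the momentum map the action is locally free. -/
lemma gen_injective (hmom : IsMomentumMap G ωM μ) {x : M}
    (hreg : Function.Surjective (differential μ x : EM →L[ℝ] (EG →L[ℝ] ℝ))) :
    Function.Injective (differential (fun a : G ↦ a • x) (1 : G) : EG →L[ℝ] EM) := by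
  rw [injective_iff_map_eq_zero]
  intro ξ hξ
  by_contra hne
  -- A functional `φ` with `φ ξ ≠ 0` would be `dμ v` for some `v`, so that `φ ξ = ω (ξ_M, v) = 0`.
  obtain ⟨φ, hφ⟩ := SeparatingDual.exists_ne_zero (R := ℝ) hne
  obtain ⟨v, rfl⟩ := hreg φ
  apply hφ
  rw [hamilton hmom]
  have : (gen G ξ x : EM) = 0 := hξ
  rw [this, map_zero, _root_.zero_apply]

omit [FiniteDimensional ℝ EM] [IsManifold 𝓘(ℝ, EM) ∞ M] [LieGroup 𝓘(ℝ, EG) ∞ G]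
  [ContMDiffSMul 𝓘(ℝ, EG) 𝓘(ℝ, EM) ∞ G M] in
/-- The symplectic orthogonal of the kernel of `dμ` consists of the generators. -/
lemma exists_gen_of_orthogonal (hnd : ∀ x u, (∀ v, formAt ωM x u v = 0) → u = 0)
    (hmom : IsMomentumMap G ωM μ) {x : M}
    (hreg : Function.Surjective (differential μ x : EM →L[ℝ] (EG →L[ℝ] ℝ))) (v : EM)
    (hv : ∀ u, (differential μ x : EM →L[ℝ] (EG →L[ℝ] ℝ)) u = 0 → formAt ωM x v u = 0) :
    ∃ ξ : EG, gen G ξ x = v := by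
  set D := (differential μ x : EM →L[ℝ] (EG →L[ℝ] ℝ))
  obtain ⟨s, hs⟩ := D.toLinearMap.exists_rightInverse_of_surjective (LinearMap.range_eq_top.2 hreg)
  have hs' : ∀ φ, D (s φ) = φ := fun φ ↦ LinearMap.congr_fun hs φ
  -- With `s` a linear section of `dμ`, `φ ↦ ω (v, s φ)` is a functional on the dual of the Lie
  -- algebra, hence evaluation at some `ξ`. As `u - s (D u)` lies in the kernel of `dμ`, this `ξ`
  -- satisfies `ω (ξ_M, u) = ω (v, u)` for all `u`.
  set l : Module.Dual ℝ (Module.Dual ℝ EG) :=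
    ((formAt ωM x v).toLinearMap ∘ₗ s) ∘ₗ LinearMap.toContinuousLinearMap.toLinearMap
  obtain ⟨ξ, hξ⟩ := (Module.evalEquiv ℝ EG).surjective l
  refine ⟨ξ, sub_eq_zero.1 (hnd x _ fun u ↦ ?_)⟩
  have h1 : formAt ωM x v (u - s (D u)) = 0 := hv _ (by rw [map_sub, hs', sub_self])
  have h2 := LinearMap.congr_fun hξ (D u).toLinearMap
  have h3 : D u ξ = formAt ωM x v (s (D u)) := h2
  rw [map_sub] at h1
  rw [map_sub, _root_.sub_apply, ← hamilton hmom, h3]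
  linarith

variable (hμ : IsEquivariant G μ) (β : EG →L[ℝ] ℝ)
  {EZ : Type*} [NormedAddCommGroup EZ] [NormedSpace ℝ EZ] [FiniteDimensional ℝ EZ]
  [ChartedSpace EZ (level hμ β)] [IsManifold 𝓘(ℝ, EZ) ∞ (level hμ β)]
  {EB : Type*} [NormedAddCommGroup EB] [NormedSpace ℝ EB] [FiniteDimensional ℝ EB]
  [ChartedSpace EB (Reduced hμ β)] [IsManifold 𝓘(ℝ, EB) ∞ (Reduced hμ β)]

omit [FiniteDimensional ℝ EM] [IsManifold 𝓘(ℝ, EM) ∞ M] [FiniteDimensional ℝ EG]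
  [ContMDiffSMul 𝓘(ℝ, EG) 𝓘(ℝ, EM) ∞ G M] [FiniteDimensional ℝ EZ]
  [IsManifold 𝓘(ℝ, EZ) ∞ (level hμ β)] in
lemma differential_momentum_incl (hs : ContMDiff 𝓘(ℝ, EM) 𝓘(ℝ, EG →L[ℝ] ℝ) ∞ μ)
    (hincl : Manifold.IsSmoothEmbedding 𝓘(ℝ, EZ) 𝓘(ℝ, EM) ∞ (incl hμ β)) (z : level hμ β)
    (w : EZ) :
    (differential μ (incl hμ β z) : EM →L[ℝ] (EG →L[ℝ] ℝ))
      ((differential (incl hμ β) z : EZ →L[ℝ] EM) w) = 0 := by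
  have h1 := differential_comp z ((hs (incl hμ β z)).mdifferentiableAt (by simp))
    ((hincl.contMDiff z).mdifferentiableAt (by simp))
  have h2 : (fun z ↦ μ (incl hμ β z)) = fun _ ↦ β := funext fun z ↦ z.2
  rw [h2, differential_const] at h1
  exact (DFunLike.congr_fun h1 w).symm

omit [FiniteDimensional ℝ EZ] [IsManifold 𝓘(ℝ, EM) ∞ M] [ContMDiffSMul 𝓘(ℝ, EG) 𝓘(ℝ, EM) ∞ G M]
  [IsManifold 𝓘(ℝ, EZ) ∞ (level hμ β)] in
/-- The tangent spaces of the level set are the kernels of `dμ`. -/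
lemma exists_of_differential_momentum_eq_zero (hs : ContMDiff 𝓘(ℝ, EM) 𝓘(ℝ, EG →L[ℝ] ℝ) ∞ μ)
    (hincl : Manifold.IsSmoothEmbedding 𝓘(ℝ, EZ) 𝓘(ℝ, EM) ∞ (incl hμ β)) (z : level hμ β)
    (hreg : Function.Surjective (differential μ (incl hμ β z) : EM →L[ℝ] (EG →L[ℝ] ℝ)))
    (v : EM) (hv : (differential μ (incl hμ β z) : EM →L[ℝ] (EG →L[ℝ] ℝ)) v = 0) :
    ∃ w : EZ, (differential (incl hμ β) z : EZ →L[ℝ] EM) w = v := by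
  -- Regularity makes a vector of `ker dμ` the velocity of a curve in the level set; embeddedness
  -- makes that curve differentiable inside it.
  obtain ⟨c, hc0, hc, hcv, hcμ⟩ := exists_curve_of_mem_ker (hs _) hreg v hv
  obtain ⟨d, hd0, hd, hcd⟩ := exists_lift_curve hincl hc hc0 (hcμ.mono fun t ht ↦
    ⟨⟨c t, ht.trans z.2⟩, rfl⟩)
  refine ⟨velocity d 0, ?_⟩
  have h1 := velocity_comp (f := incl hμ β) ((hincl.contMDiff (d 0)).mdifferentiableAt (by simp)) hd
  rw [velocity_congr hcd, hd0] at h1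
  exact h1.symm.trans hcv

omit [FiniteDimensional ℝ EM] [IsManifold 𝓘(ℝ, EM) ∞ M] [FiniteDimensional ℝ EB]
  [FiniteDimensional ℝ EZ] [IsManifold 𝓘(ℝ, EZ) ∞ (level hμ β)]
  [IsManifold 𝓘(ℝ, EB) ∞ (Reduced hμ β)] in
/-- Generators that are tangent to the level set are vertical. -/
lemma exists_vertical_of_gen (hs : ContMDiff 𝓘(ℝ, EM) 𝓘(ℝ, EG →L[ℝ] ℝ) ∞ μ)
    (hincl : Manifold.IsSmoothEmbedding 𝓘(ℝ, EZ) 𝓘(ℝ, EM) ∞ (incl hμ β))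
    (hproj : Manifold.IsSubmersion 𝓘(ℝ, EZ) 𝓘(ℝ, EB) ∞ (proj hμ β)) (z : level hμ β) (ξ : EG)
    (hξ : (differential μ (incl hμ β z) : EM →L[ℝ] (EG →L[ℝ] ℝ)) (gen G ξ (incl hμ β z)) = 0) :
    ∃ w : EZ, (differential (incl hμ β) z : EZ →L[ℝ] EM) w = gen G ξ (incl hμ β z) ∧
      (differential (proj hμ β) z : EZ →L[ℝ] EB) w = 0 := by
  obtain ⟨γ, hγ0, hγ⟩ := exists_curve_of_mulInvariantVectorField (G := G) ξ
  have hμγ := eventually_map_orbit_eq hμ hs (incl hμ β z) hξ hγ0 hγ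
  have hz : μ (incl hμ β z) = β := z.2
  have hc : MDifferentiableAt 𝓘(ℝ, ℝ) 𝓘(ℝ, EM) (fun t ↦ γ t • incl hμ β z) 0 :=
    MDifferentiableAt.comp (g := fun a : G ↦ a • incl hμ β z) 0
      (((contMDiff_orbit _) _).mdifferentiableAt (by simp)) hγ.self_of_nhds.1
  obtain ⟨d, hd0, hd, hcd⟩ := exists_lift_curve hincl hc (x := z) (by rw [hγ0, one_smul])
    (hμγ.mono fun t ht ↦ ⟨⟨γ t • incl hμ β z, ht.trans hz⟩, rfl⟩)
  refine ⟨velocity d 0, ?_, ?_⟩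
  · have h1 := velocity_comp (f := incl hμ β) ((hincl.contMDiff (d 0)).mdifferentiableAt (by simp))
      hd
    rw [velocity_congr hcd, hd0, velocity_orbit _ hγ.self_of_nhds.1 hγ.self_of_nhds.2, hγ0] at h1
    rw [← h1]
    have h2 : (fun y : M ↦ (1 : G) • y) = fun y ↦ y := funext fun y ↦ one_smul G y
    rw [h2, differential_fun_id]
    rfl
  · have h1 := velocity_comp (f := proj hμ β) ((hproj.contMDiff (d 0)).mdifferentiableAt (by simp))
      hd
    have h2 : ∀ᶠ t in 𝓝 0, proj hμ β (d t) = proj hμ β z := by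
      filter_upwards [hμγ, hcd] with t ht hdt
      refine Quotient.sound ?_
      -- The orbit stays at level `β`, so equivariance forces `γ t` into the isotropy group, and the
      -- projection is constant along the curve.
      have hi : coAd (γ t) β = β := by
        rw [← hz, ← hμ, ht]
      exact ⟨(⟨γ t, hi⟩ : isotropy G β), Subtype.ext hdt.symm⟩
    rw [velocity_congr h2, velocity_const, hd0] at h1
    exact h1.symm

omit [FiniteDimensional ℝ EM] [IsManifold 𝓘(ℝ, EM) ∞ M] [FiniteDimensional ℝ EG] in
/-- The points of an orbit near `z` are obtained from `z` by group elements near the identity. -/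
lemma tendsto_one_of_proper (hfree : ∀ (a : isotropy G β) (z : level hμ β), a • z = z → a = 1)
    (hproper : ProperSMul (isotropy G β) (level hμ β)) {z : level hμ β} {g : ℝ → isotropy G β}
    {c : ℝ → level hμ β} (hc : Tendsto c (𝓝 0) (𝓝 z)) (hg : ∀ᶠ t in 𝓝 0, g t • z = c t) :
    Tendsto g (𝓝 0) (𝓝 1) := by
  rw [tendsto_iff_ultrafilter]
  intro U hU
  obtain ⟨-, hp⟩ := properSMul_iff_continuousSMul_ultrafilter_tendsto.1 hproper
  -- The pairs `(g t • z, z)` tend to `(z, z)`; properness gives a limit `a` of `g` along the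
  -- ultrafilter with `a • z = z`, and freeness gives `a = 1`.
  obtain ⟨a, ha, hU'⟩ := hp (U.map fun t ↦ (g t, z)) z z (by
    rw [Ultrafilter.coe_map, tendsto_map'_iff]
    refine Tendsto.prodMk_nhds ?_ tendsto_const_nhds
    exact (hc.congr' (hg.mono fun t ht ↦ ht.symm)).mono_left hU)
  rw [hfree a z ha, Ultrafilter.coe_map, tendsto_map'_iff] at hU'
  exact hU'

omit [IsManifold 𝓘(ℝ, EZ) ∞ (level hμ β)] [IsManifold 𝓘(ℝ, EB) ∞ (Reduced hμ β)] in
/-- Vertical vectors are generators. -/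
lemma exists_gen_of_vertical (hmom : IsMomentumMap G ωM μ)
    (hincl : Manifold.IsSmoothEmbedding 𝓘(ℝ, EZ) 𝓘(ℝ, EM) ∞ (incl hμ β))
    (hproj : Manifold.IsSubmersion 𝓘(ℝ, EZ) 𝓘(ℝ, EB) ∞ (proj hμ β))
    (hfree : ∀ (a : isotropy G β) (z : level hμ β), a • z = z → a = 1)
    (hproper : ProperSMul (isotropy G β) (level hμ β)) (z : level hμ β)
    (hreg : Function.Surjective (differential μ (incl hμ β z) : EM →L[ℝ] (EG →L[ℝ] ℝ)))
    (w : EZ) (hw : (differential (proj hμ β) z : EZ →L[ℝ] EB) w = 0) :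
    ∃ ξ : EG, gen G ξ (incl hμ β z) = (differential (incl hμ β) z : EZ →L[ℝ] EM) w := by
  obtain ⟨c, hc0, hc, hcv, hcπ⟩ := exists_curve_of_mem_ker (hproj.contMDiff z)
    (surjective_differential_of_isSubmersionAt (hproj.isSubmersionAt z)) w hw
  have hex : ∀ t, ∃ a : isotropy G β, proj hμ β (c t) = proj hμ β z → a • z = c t := fun t ↦ by
    by_cases h : proj hμ β (c t) = proj hμ β z
    · obtain ⟨a, ha⟩ := Quotient.exact h
      exact ⟨a, fun _ ↦ ha⟩
    · exact ⟨1, fun h' ↦ (h h').elim⟩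
  choose g hg using hex
  have hgc : ∀ᶠ t in 𝓝 0, g t • z = c t := hcπ.mono fun t ht ↦ hg t ht
  have hg0 : g 0 = 1 := hfree _ z (by rw [hg 0 (by rw [hc0]), hc0])
  have hct : Tendsto c (𝓝 0) (𝓝 z) := by
    have := hc.continuousAt.tendsto
    rwa [hc0] at this
  have hg1 : Tendsto (fun t ↦ (g t : G)) (𝓝 0) (𝓝 1) :=
    (continuous_subtype_val.tendsto (1 : isotropy G β)).comp
      (tendsto_one_of_proper hμ β hfree hproper hct hgc)
  have : IsManifold 𝓘(ℝ, EG) ∞ G := LieGroup.toContMDiffMul.toIsManifold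
  obtain ⟨r, hr, hro⟩ := exists_local_retraction_of_injective
    ((contMDiff_orbit (G := G) (incl hμ β z)) 1) (gen_injective hmom hreg)
  have hic : MDifferentiableAt 𝓘(ℝ, ℝ) 𝓘(ℝ, EM) (fun t ↦ incl hμ β (c t)) 0 :=
    MDifferentiableAt.comp (g := incl hμ β) 0 ((hincl.contMDiff _).mdifferentiableAt (by simp)) hc
  have horb : ∀ᶠ t in 𝓝 0, (g t : G) • incl hμ β z = incl hμ β (c t) :=
    hgc.mono fun t ht ↦ congrArg Subtype.val ht
  -- The group elements `g t` were merely chosen. Since they tend to the identity, a local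
  -- retraction `r` of the orbit map recovers them as `r (incl (c t))`, hence differentiably; the
  -- whole argument takes place in `G`.
  have hgd : MDifferentiableAt 𝓘(ℝ, ℝ) 𝓘(ℝ, EG) (fun t ↦ (g t : G)) 0 := by
    have h1 : MDifferentiableAt 𝓘(ℝ, ℝ) 𝓘(ℝ, EG) (fun t ↦ r (incl hμ β (c t))) 0 := by
      refine MDifferentiableAt.comp (I' := 𝓘(ℝ, EM)) (g := r) 0 ?_ hic
      simpa [hc0] using hr
    refine h1.congr_of_eventuallyEq ?_
    filter_upwards [hg1.eventually hro, horb] with t ht ht'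
    rw [← ht', ht]
  refine ⟨velocity (fun t ↦ (g t : G)) 0, ?_⟩
  have h1 := velocity_comp (f := fun a : G ↦ a • incl hμ β z)
    (((contMDiff_orbit (EM := EM) (EG := EG) (G := G) (incl hμ β z)) (g 0 : G)).mdifferentiableAt
      (by simp)) hgd
  have h2 := velocity_comp (f := incl hμ β) ((hincl.contMDiff (c 0)).mdifferentiableAt (by simp)) hc
  rw [velocity_congr horb, h2, hc0, hg0] at h1
  have h3 : (velocity c 0 : EZ) = w := hcv
  rw [h3] at h1
  exact h1.symm

end Level

/-! ### Forms on the base of a submersion. -/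

section Descent

open Filter Topology

variable {E : Type*} [NormedAddCommGroup E] [NormedSpace ℝ E]
  {N : Type*} [TopologicalSpace N] [ChartedSpace E N]
  {E' : Type*} [NormedAddCommGroup E'] [NormedSpace ℝ E']
  {N' : Type*} [TopologicalSpace N'] [ChartedSpace E' N']
  {E'' : Type*} [NormedAddCommGroup E''] [NormedSpace ℝ E'']
  {N'' : Type*} [TopologicalSpace N''] [ChartedSpace E'' N'']

/-- Every point of the base and every tangent vector there is hit by `f` and its differential. -/
lemma eq_of_pullback_eq {f : N' → N} {b b' : BilinField E N}
    (hf : Manifold.IsSubmersion 𝓘(ℝ, E') 𝓘(ℝ, E) ∞ f) (hsurj : Function.Surjective f)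
    (hb : pullback (E' := E') f b = pullback (E' := E') f b') : b = b' := by
  funext x
  obtain ⟨z, rfl⟩ := hsurj x
  have hd := surjective_differential_of_isSubmersionAt (hf.isSubmersionAt z)
  have h1 := congrFun hb z
  refine ContinuousLinearMap.ext fun u ↦ ContinuousLinearMap.ext fun v ↦ ?_
  obtain ⟨u, rfl⟩ := hd u
  obtain ⟨v, rfl⟩ := hd v
  exact DFunLike.congr_fun (DFunLike.congr_fun h1 u) v

variable [IsManifold 𝓘(ℝ, E) ∞ N] [IsManifold 𝓘(ℝ, E') ∞ N']

lemma IsSymplecticForm.isSmoothFormAt {σ : BilinField E N} (hω : IsSymplecticForm σ) (x : N) :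
    IsSmoothFormAt σ x := hω.smooth x

lemma IsSymplecticForm.formAt_self {σ : BilinField E N} (hω : IsSymplecticForm σ) (x : N) (u : E) :
    formAt σ x u u = 0 := hω.alternating x u

lemma IsSymplecticForm.eq_zero {σ : BilinField E N} (hω : IsSymplecticForm σ) (x : N) (u : E)
    (hu : ∀ v : E, formAt σ x u v = 0) : u = 0 := hω.nondegenerate x u hu

lemma IsSymplecticForm.formAt_swap {σ : BilinField E N} (hω : IsSymplecticForm σ) (x : N)
    (u v : E) : formAt σ x u v = -formAt σ x v u := by
  have h := hω.formAt_self x (u + v)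
  simp only [map_add, _root_.add_apply, hω.formAt_self x u, hω.formAt_self x v] at h
  linarith

lemma IsSymplecticForm.isClosedAt {σ : BilinField E N} (hω : IsSymplecticForm σ) (x : N) (y : E)
    (hy : y ∈ (extChartAt 𝓘(ℝ, E) x).target) : IsClosedAt (chartForm σ x) y := hω.closed x y hy

/-- A form on the base of a submersion is, locally, a pull-back by a section. -/
lemma exists_section_formAt_eq {f : N' → N} {i : N' → N''}
    {b : BilinField E N} {σ : BilinField E'' N''}
    (hf : Manifold.IsSubmersion 𝓘(ℝ, E') 𝓘(ℝ, E) ∞ f)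
    (hi : ContMDiff 𝓘(ℝ, E') 𝓘(ℝ, E'') ∞ i)
    (hb : pullback (E' := E') f b = pullback (E' := E') i σ) (z : N') :
    ∃ s : N → N'', ContMDiffAt 𝓘(ℝ, E) 𝓘(ℝ, E'') ∞ s (f z) ∧
      ∀ᶠ y in 𝓝 (f z), formAt b y = formAt (E := E) (pullback s σ) y := by
  obtain ⟨s, hs, -, hfs⟩ := exists_local_section (hf.isSubmersionAt z)
  refine ⟨fun y ↦ i (s y), (hi _).comp _ hs, ?_⟩
  have : IsManifold 𝓘(ℝ, E) 1 N := IsManifold.of_le (n := ∞) (by simp)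
  have : IsManifold 𝓘(ℝ, E') 1 N' := IsManifold.of_le (n := ∞) (by simp)
  have hs1 : ContMDiffAt 𝓘(ℝ, E) 𝓘(ℝ, E') 1 s (f z) := hs.of_le (by simp)
  have hs2 : ∀ᶠ y in 𝓝 (f z), MDifferentiableAt 𝓘(ℝ, E) 𝓘(ℝ, E') s y :=
    ((contMDiffAt_iff_contMDiffAt_nhds (by simp)).1 hs1).mono fun y hy ↦
      hy.mdifferentiableAt (by simp)
  filter_upwards [hs2, hfs.eventually_nhds] with y hsy hfy
  calc formAt b y = formAt (E := E) (pullback (fun y ↦ y) b) y := by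
        rw [formAt_pullback, differential_fun_id]
        rfl
    _ = formAt (E := E) (pullback (fun y ↦ f (s y)) b) y :=
        (formAt_pullback_congr hfy (by rw [hfy.self_of_nhds])).symm
    _ = formAt (E := E) (pullback s (pullback (E' := E') f b)) y :=
        formAt_pullback_comp b ((hf.contMDiff _).mdifferentiableAt (by simp)) hsy
    _ = formAt (E := E) (pullback (fun y ↦ i (s y)) σ) y := by
        rw [hb, formAt_pullback_comp σ ((hi _).mdifferentiableAt (by simp)) hsy]

variable [IsManifold 𝓘(ℝ, E'') ∞ N'']

/-- The criterion for a form on the base of a submersion to be symplectic. -/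
lemma isSymplecticForm_of_pullback_eq {f : N' → N} {i : N' → N''}
    {b : BilinField E N} {σ : BilinField E'' N''}
    (hf : Manifold.IsSubmersion 𝓘(ℝ, E') 𝓘(ℝ, E) ∞ f) (hsurj : Function.Surjective f)
    (hi : ContMDiff 𝓘(ℝ, E') 𝓘(ℝ, E'') ∞ i) (hω : IsSymplecticForm σ)
    (hb : pullback (E' := E') f b = pullback (E' := E') i σ)
    (hker : ∀ z (w : E'), (∀ u : E', formAt (E := E') (pullback i σ) z w u = 0) →
      (differential f z : E' →L[ℝ] E) w = 0) : IsSymplecticForm b where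
  smooth x := by
    obtain ⟨z, rfl⟩ := hsurj x
    obtain ⟨s, hs, hbs⟩ := exists_section_formAt_eq hf hi hb z
    exact ((hω.isSmoothFormAt _).pullback hs).congr hbs
  alternating x u := by
    obtain ⟨z, rfl⟩ := hsurj x
    obtain ⟨v, rfl⟩ := surjective_differential_of_isSubmersionAt (hf.isSubmersionAt z) u
    have h1 := congrFun hb z
    exact (DFunLike.congr_fun (DFunLike.congr_fun h1 v) v).trans (hω.alternating _ _)
  nondegenerate x u hu := by
    obtain ⟨z, rfl⟩ := hsurj x
    obtain ⟨v, rfl⟩ := surjective_differential_of_isSubmersionAt (hf.isSubmersionAt z) u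
    have h1 := congrFun hb z
    exact hker z v fun w ↦ (DFunLike.congr_fun (DFunLike.congr_fun h1 v) w).symm.trans (hu _)
  closed x y hy := by
    obtain ⟨z, hz⟩ := hsurj ((extChartAt 𝓘(ℝ, E) x).symm y)
    obtain ⟨s, hs, hbs⟩ := exists_section_formAt_eq hf hi hb z
    rw [hz] at hs hbs
    have h1 : IsClosedAt (chartForm b x) y :=
      (isClosedAt_chartForm_pullback hy hs hω.isSmoothFormAt hω.formAt_self hω.isClosedAt).congr
        (chartForm_congr hy hbs)
    exact h1

end Descent

/-! ### The tangential part of an almost complex structure on a submanifold. -/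

section Induced

variable {E : Type*} [NormedAddCommGroup E] [NormedSpace ℝ E]
  {N : Type*} [TopologicalSpace N] [ChartedSpace E N] [IsManifold 𝓘(ℝ, E) ∞ N]
  {E' : Type*} [NormedAddCommGroup E'] [NormedSpace ℝ E']
  {N' : Type*} [TopologicalSpace N'] [ChartedSpace E' N']

lemma formAt_pullback_pos {i : N' → N} (g : RiemMetric E N) {z : N'}
    (hi : Function.Injective (differential i z : E' →L[ℝ] E)) (v : E') (hv : v ≠ 0) :
    0 < formAt (E := E') (pullback i g.inner) z v v :=
  g.pos (i z) _ (by
    intro h0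
    exact hv (hi (h0.trans (map_zero _).symm)))

/-- Since `σ = g (J ·, ·)`, orthogonality of `J u - J' u` to the submanifold says exactly that `J'`
represents the restriction of `σ` with respect to the induced metric; only this form is used later.
-/
lemma isInducedEndField_iff {i : N' → N} {g : RiemMetric E N} {J : EndField E N}
    {σ : BilinField E N} (hc : IsCompatible σ J g.inner) {J' : EndField E' N'} :
    IsInducedEndField i g.inner J J' ↔ ∀ z (u v : E'),
      formAt (E := E') (pullback i g.inner) z ((J' z : E' →L[ℝ] E') u) v =
        formAt (E := E') (pullback i σ) z u v := by
  refine forall_congr' fun z ↦ forall_congr' fun u ↦ forall_congr' fun v ↦ ?_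
  set du : E := (differential i z : E' →L[ℝ] E) u
  set dv : E := (differential i z : E' →L[ℝ] E) v
  set dJ : E := (differential i z : E' →L[ℝ] E) ((J' z : E' →L[ℝ] E') u)
  have h1 : formAt σ (i z) du dv = formAt (g.inner) (i z) ((J (i z) : E →L[ℝ] E) du) dv :=
    hc (i z) du dv
  set Jdu : E := (J (i z) : E →L[ℝ] E) du
  change formAt (g.inner) (i z) (Jdu - dJ) dv = 0 ↔
    formAt g.inner (i z) dJ dv = formAt σ (i z) du dv
  rw [h1, map_sub, _root_.sub_apply, sub_eq_zero, eq_comm]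

/-- Existence and uniqueness of the tangential part of an endomorphism field. -/
lemma existsUnique_isInducedEndField [FiniteDimensional ℝ E'] {i : N' → N} {g : RiemMetric E N}
    {J : EndField E N} {σ : BilinField E N} (hc : IsCompatible σ J g.inner)
    (hi : ∀ z, Function.Injective (differential i z : E' →L[ℝ] E)) :
    ∃! J' : EndField E' N', IsInducedEndField i g.inner J J' := by
  have h := fun z ↦ exists_endomorphism_of_definite (formAt (E := E') (pullback i g.inner) z)
    (formAt (E := E') (pullback i σ) z) (formAt_pullback_pos g (hi z))
  choose J' hJ' using h
  refine ⟨fun z ↦ J' z, (isInducedEndField_iff hc).2 hJ', fun K hK ↦ ?_⟩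
  replace hK := (isInducedEndField_iff hc).1 hK
  have key : ∀ z (u v k : E'), k = (K z : E' →L[ℝ] E') u →
      formAt (E := E') (pullback i g.inner) z (k - J' z u) v = 0 := by
    intro z u v k hk
    rw [map_sub, _root_.sub_apply, hk, hK, hJ', sub_self]
  funext z
  refine ContinuousLinearMap.ext fun u ↦ ?_
  set k : E' := (K z : E' →L[ℝ] E') u
  change k = J' z u
  by_contra hne
  exact (formAt_pullback_pos g (hi z) (k - J' z u) (sub_ne_zero.2 hne)).ne' (key z u _ k rfl)

end Induced

/-! ### The reduced symplectic form. -/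

section Reduction

open Filter Topology

variable {EM : Type*} [NormedAddCommGroup EM] [NormedSpace ℝ EM] [FiniteDimensional ℝ EM]
  {M : Type*} [TopologicalSpace M] [ChartedSpace EM M] [IsManifold 𝓘(ℝ, EM) ∞ M]
  {EG : Type*} [NormedAddCommGroup EG] [NormedSpace ℝ EG] [FiniteDimensional ℝ EG]
  {G : Type*} [TopologicalSpace G] [ChartedSpace EG G] [Group G] [LieGroup 𝓘(ℝ, EG) ∞ G]
  [MulAction G M] [ContMDiffSMul 𝓘(ℝ, EG) 𝓘(ℝ, EM) ∞ G M]
  {ωM : BilinField EM M} {μ : M → (EG →L[ℝ] ℝ)}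
  (hμ : IsEquivariant G μ) (β : EG →L[ℝ] ℝ)
  {EZ : Type*} [NormedAddCommGroup EZ] [NormedSpace ℝ EZ] [FiniteDimensional ℝ EZ]
  [ChartedSpace EZ (level hμ β)] [IsManifold 𝓘(ℝ, EZ) ∞ (level hμ β)]
  {EB : Type*} [NormedAddCommGroup EB] [NormedSpace ℝ EB] [FiniteDimensional ℝ EB]
  [ChartedSpace EB (Reduced hμ β)]

omit [IsManifold 𝓘(ℝ, EZ) ∞ (level hμ β)] in
/-- The kernel of the restriction of the symplectic form to the level set consists of the vertical
vectors. -/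
lemma differential_proj_eq_zero_iff (hω : IsSymplecticForm ωM) (hmom : IsMomentumMap G ωM μ)
    (hreg : ∀ x, μ x = β → Function.Surjective (differential μ x : EM →L[ℝ] (EG →L[ℝ] ℝ)))
    (hincl : Manifold.IsSmoothEmbedding 𝓘(ℝ, EZ) 𝓘(ℝ, EM) ∞ (incl hμ β))
    (hfree : ∀ (a : isotropy G β) (z : level hμ β), a • z = z → a = 1)
    (hproper : ProperSMul (isotropy G β) (level hμ β))
    (hproj : Manifold.IsSubmersion 𝓘(ℝ, EZ) 𝓘(ℝ, EB) ∞ (proj hμ β)) (z : level hμ β) (w : EZ) :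
    (differential (proj hμ β) z : EZ →L[ℝ] EB) w = 0 ↔
      ∀ u : EZ, formAt (E := EZ) (pullback (incl hμ β) ωM) z w u = 0 := by
  have hz := hreg (incl hμ β z) z.2
  constructor
  · intro hw u
    -- A vertical vector is a generator, and `ω (ξ_M, u) = dμ u ξ = 0` for `u` tangent to the level
    -- set.
    obtain ⟨ξ, hξ⟩ := exists_gen_of_vertical hμ β hmom hincl hproj hfree hproper z hz w hw
    rw [formAt_pullback, ContinuousLinearMap.bilinearComp_apply, ← hξ, ← hamilton hmom,
      differential_momentum_incl hμ β hmom.smooth hincl, _root_.zero_apply]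
  · intro hw
    -- A tangent vector orthogonal to `ker dμ` is a generator. Being tangent to the level set, this
    -- generator is also the image of a vertical vector, which is `w` by injectivity of the
    -- differential of the inclusion.
    obtain ⟨ξ, hξ⟩ := exists_gen_of_orthogonal (x := incl hμ β z) hω.eq_zero hmom hz
      ((differential (incl hμ β) z : EZ →L[ℝ] EM) w) fun v hv ↦ by
        obtain ⟨u, rfl⟩ :=
          exists_of_differential_momentum_eq_zero hμ β hmom.smooth hincl z hz v hv
        exact hw u
    obtain ⟨w', hw', hπ⟩ := exists_vertical_of_gen hμ β hmom.smooth hincl hproj z ξ (by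
      rw [hξ, differential_momentum_incl hμ β hmom.smooth hincl])
    have hinj := injective_differential_of_isImmersionAt (hincl.isImmersion.isImmersionAt z)
    rwa [hinj (hw'.trans hξ)] at hπ

omit [FiniteDimensional ℝ EM] [IsManifold 𝓘(ℝ, EM) ∞ M] [FiniteDimensional ℝ EG]
  [FiniteDimensional ℝ EZ] [IsManifold 𝓘(ℝ, EZ) ∞ (level hμ β)] in
-- A continuous map into an immersed manifold is smooth once its composite with the immersion is,
-- and that composite is the smooth action on `M`; continuity belongs to properness.
lemma contMDiff_smul_level
    (hincl : Manifold.IsSmoothEmbedding 𝓘(ℝ, EZ) 𝓘(ℝ, EM) ∞ (incl hμ β))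
    (hproper : ProperSMul (isotropy G β) (level hμ β)) (a : isotropy G β) :
    ContMDiff 𝓘(ℝ, EZ) 𝓘(ℝ, EZ) ∞ (fun z : level hμ β ↦ a • z) := by
  intro z
  rw [ContMDiffAt.iff_comp_isImmersionAt (hincl.isImmersion.isImmersionAt _)]
  refine ⟨(continuous_const_smul a).continuousAt, ?_⟩
  have h1 : ContMDiff 𝓘(ℝ, EM) 𝓘(ℝ, EM) ∞ (fun y : M ↦ (a : G) • y) :=
    ContMDiffSMul.contMDiff_const_smul (I := 𝓘(ℝ, EG)) (n := ∞) (a : G)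
  exact (h1.comp hincl.contMDiff) z

omit [FiniteDimensional ℝ EM] [IsManifold 𝓘(ℝ, EM) ∞ M] [FiniteDimensional ℝ EG]
  [FiniteDimensional ℝ EZ] [IsManifold 𝓘(ℝ, EZ) ∞ (level hμ β)] [FiniteDimensional ℝ EB] in
omit [FiniteDimensional ℝ EB] in
/-- The restriction of the symplectic form to the level set is compatible with the fibres of the
projection. -/
lemma exists_differential_of_proj_eq (hsymp : IsInvariant G ωM)
    (hincl : Manifold.IsSmoothEmbedding 𝓘(ℝ, EZ) 𝓘(ℝ, EM) ∞ (incl hμ β))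
    (hproper : ProperSMul (isotropy G β) (level hμ β))
    (hproj : Manifold.IsSubmersion 𝓘(ℝ, EZ) 𝓘(ℝ, EB) ∞ (proj hμ β)) {z z' : level hμ β}
    (h : proj hμ β z = proj hμ β z') :
    ∃ T : EZ →L[ℝ] EZ,
      (differential (proj hμ β) z' : EZ →L[ℝ] EB).comp T = differential (proj hμ β) z ∧
      ∀ u v, formAt (E := EZ) (pullback (incl hμ β) ωM) z' (T u) (T v) =
        formAt (E := EZ) (pullback (incl hμ β) ωM) z u v := by
  obtain ⟨a, rfl⟩ := Quotient.exact h.symm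
  have ha := ((contMDiff_smul_level hμ β hincl hproper a) z).mdifferentiableAt
    (by simp : (∞ : WithTop ℕ∞) ≠ 0)
  have hM : MDifferentiableAt 𝓘(ℝ, EM) 𝓘(ℝ, EM) (fun y : M ↦ (a : G) • y) (incl hμ β z) :=
    ((ContMDiffSMul.contMDiff_const_smul (I := 𝓘(ℝ, EG)) (n := ∞) (a : G)) _).mdifferentiableAt
      (by simp)
  refine ⟨differential (fun z : level hμ β ↦ a • z) z, ?_, fun u v ↦ ?_⟩
  · have h1 := differential_comp z ((hproj.contMDiff (a • z)).mdifferentiableAt (by simp)) ha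
    have h2 : (fun z ↦ proj hμ β (a • z)) = proj hμ β := funext fun z ↦ Quotient.sound ⟨a, rfl⟩
    rw [h2] at h1
    exact h1.symm
  · have h1 := differential_comp z ((hincl.contMDiff (a • z)).mdifferentiableAt (by simp)) ha
    have h2 := differential_comp z hM ((hincl.contMDiff z).mdifferentiableAt (by simp))
    have h3 : ∀ w : EZ, (differential (incl hμ β) (a • z) : EZ →L[ℝ] EM)
        ((differential (fun z : level hμ β ↦ a • z) z : EZ →L[ℝ] EZ) w) =
        (differential (fun y : M ↦ (a : G) • y) (incl hμ β z) : EM →L[ℝ] EM)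
          ((differential (incl hμ β) z : EZ →L[ℝ] EM) w) :=
      fun w ↦ DFunLike.congr_fun (h1.symm.trans h2) w
    rw [formAt_pullback, ContinuousLinearMap.bilinearComp_apply, h3, h3]
    exact hsymp (a : G) (incl hμ β z) _ _

omit [TopologicalSpace M] [FiniteDimensional ℝ EG] in
lemma proj_surjective : Function.Surjective (proj hμ β) := Quotient.mk_surjective

/-- Existence and uniqueness of the reduced symplectic form. -/
theorem existsUnique_reduced_form [IsManifold 𝓘(ℝ, EB) ∞ (Reduced hμ β)]
    (hω : IsSymplecticForm ωM) (hsymp : IsInvariant G ωM) (hmom : IsMomentumMap G ωM μ)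
    (hreg : ∀ x, μ x = β → Function.Surjective (differential μ x : EM →L[ℝ] (EG →L[ℝ] ℝ)))
    (hincl : Manifold.IsSmoothEmbedding 𝓘(ℝ, EZ) 𝓘(ℝ, EM) ∞ (incl hμ β))
    (hfree : ∀ (a : isotropy G β) (z : level hμ β), a • z = z → a = 1)
    (hproper : ProperSMul (isotropy G β) (level hμ β))
    (hproj : Manifold.IsSubmersion 𝓘(ℝ, EZ) 𝓘(ℝ, EB) ∞ (proj hμ β)) :
    ∃! ωβ : BilinField EB (Reduced hμ β), IsSymplecticForm ωβ ∧
      pullback (E' := EZ) (proj hμ β) ωβ = pullback (E' := EZ) (incl hμ β) ωM := by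
  have hker := differential_proj_eq_zero_iff hμ β hω hmom hreg hincl hfree hproper hproj
  obtain ⟨ωβ, hωβ⟩ := exists_pullback_eq (proj_surjective hμ β)
    (fun z ↦ surjective_differential_of_isSubmersionAt (hproj.isSubmersionAt z))
    (pullback (E' := EZ) (incl hμ β) ωM)
    (fun z k hk u ↦ by
      have h1 := (hker z k).1 hk u
      refine ⟨h1, ?_⟩
      rw [formAt_pullback, ContinuousLinearMap.bilinearComp_apply] at h1 ⊢
      rw [hω.formAt_swap, h1, neg_zero])
    (fun z z' h ↦ exists_differential_of_proj_eq hμ β hsymp hincl hproper hproj h)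
  refine ⟨ωβ, ⟨?_, hωβ⟩, fun ω' h' ↦ ?_⟩
  · exact isSymplecticForm_of_pullback_eq hproj (proj_surjective hμ β) hincl.contMDiff hω hωβ
      fun z w hw ↦ (hker z w).2 hw
  · exact eq_of_pullback_eq hproj (proj_surjective hμ β) (h'.2.trans hωβ.symm)

end Reduction

/-! ### The equivalence for a submersion with matching pull-backs. -/

section Submersion

variable {E : Type*} [NormedAddCommGroup E] [NormedSpace ℝ E]
  {N : Type*} [TopologicalSpace N] [ChartedSpace E N] [IsManifold 𝓘(ℝ, E) ∞ N]
  {E' : Type*} [NormedAddCommGroup E'] [NormedSpace ℝ E'] [FiniteDimensional ℝ E']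
  {N' : Type*} [TopologicalSpace N'] [ChartedSpace E' N']
  {E'' : Type*} [NormedAddCommGroup E''] [NormedSpace ℝ E'']
  {N'' : Type*} [TopologicalSpace N''] [ChartedSpace E'' N''] [IsManifold 𝓘(ℝ, E'') ∞ N'']

/-- Let the forms `ω` on `N''` and `b` on the base `N` of a submersion `f : N' → N` have the same
pull-back to `N'`. Then `b` and an almost complex structure on `N` come from a metric for which `f`
is a Riemannian submersion if and only if `f` is almost complex. -/
theorem exists_riemMetric_iff_isAlmostComplexMap [FiniteDimensional ℝ E] {f : N' → N}
    {i : N' → N''} {b : BilinField E N}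
    {σ : BilinField E'' N''} {g : RiemMetric E'' N''} {J : EndField E'' N''} {J' : EndField E' N'}
    (hf : Manifold.IsSubmersion 𝓘(ℝ, E') 𝓘(ℝ, E) ∞ f) (hsurj : Function.Surjective f)
    (hi : ∀ z, Function.Injective (differential i z : E' →L[ℝ] E''))
    (hc : IsCompatible σ J g.inner) (hJ' : IsInducedEndField i g.inner J J')
    (hb : IsSymplecticForm b) (hbσ : pullback (E' := E') f b = pullback (E' := E') i σ)
    {Jβ : EndField E N} (hJβ : IsAlmostComplexStructure Jβ) :
    (∃ gβ : RiemMetric E N,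
        IsRiemannianSubmersion f (pullback (E' := E') i g.inner) gβ.inner ∧
        IsCompatible b Jβ gβ.inner) ↔ IsAlmostComplexMap f J' Jβ := by
  have hd := fun z ↦ surjective_differential_of_isSubmersionAt (hf.isSubmersionAt z)
  have hσ : ∀ z (u v : E'), formAt b (f z) ((differential f z : E' →L[ℝ] E) u)
      ((differential f z : E' →L[ℝ] E) v) = formAt (E := E') (pullback i σ) z u v := fun z u v ↦
    DFunLike.congr_fun (DFunLike.congr_fun (congrFun hbσ z) u) v
  have hind := (isInducedEndField_iff hc).1 hJ'
  have hpos := fun z ↦ formAt_pullback_pos g (hi z)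
  constructor
  · rintro ⟨gβ, hsub, hcβ⟩ z u
    exact comm_of_isometry (σ := formAt (E := E') (pullback i σ) z)
      (g := formAt (E := E') (pullback i g.inner) z) (p := differential f z) (J' := J' z)
      (ωβ := formAt b (f z)) (gβ := formAt gβ.inner (f z)) (Jβ := Jβ (f z))
      (hpos z) (hd z) (hσ z) (hind z) (gβ.pos (f z)) (hcβ (f z)) (hsub.isometry z) u
  · intro hac
    have key := fun z ↦ metric_of_comm (σ := formAt (E := E') (pullback i σ) z)
      (g := formAt (E := E') (pullback i g.inner) z) (p := differential f z) (J' := J' z)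
      (ωβ := formAt b (f z)) (gβ := formAt (negComp b Jβ) (f z)) (Jβ := Jβ (f z))
      (fun u v ↦ g.symm (i z) _ _) (hpos z) (hd z) (hσ z) (hind z) (hb.formAt_self _)
      (hb.eq_zero _) (hJβ.sq_eq_neg _) (hac z) (fun _ _ ↦ rfl)
    have hposβ : ∀ x (u : E), u ≠ 0 → 0 < formAt (negComp b Jβ) x u u := fun x ↦ by
      obtain ⟨z, rfl⟩ := hsurj x
      exact (key z).2.1
    -- As `Jβ` squares to `-1`, compatibility leaves `-b (Jβ ·, ·)` as the only possible metric; it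
    -- is smooth because `b` and `Jβ` are.
    refine ⟨⟨negComp b Jβ, fun x ↦ ?_, hposβ, fun x ↦ ?_, fun x ↦ ?_⟩, ⟨hf.contMDiff, hd, ?_⟩, ?_⟩
    · obtain ⟨z, rfl⟩ := hsurj x
      exact (key z).1
    · exact isVonNBounded_of_definite (formAt (negComp b Jβ) x) (hposβ x)
    · exact (hb.isSmoothFormAt x).negComp (hJβ.smooth x)
    · exact fun z ↦ (key z).2.2.2
    · intro x
      obtain ⟨z, rfl⟩ := hsurj x
      exact (key z).2.2.1

end Submersion

end SymplecticReduction

end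

theorem mainTheorem1
    -- the manifold `M` and the Lie group `G` acting smoothly on it
    {EM : Type*} [NormedAddCommGroup EM] [NormedSpace ℝ EM] [FiniteDimensional ℝ EM]
    {M : Type*} [TopologicalSpace M] [T2Space M] [ChartedSpace EM M] [IsManifold 𝓘(ℝ, EM) ∞ M]
    {EG : Type*} [NormedAddCommGroup EG] [NormedSpace ℝ EG] [FiniteDimensional ℝ EG]
    {G : Type*} [TopologicalSpace G] [ChartedSpace EG G] [Group G] [LieGroup 𝓘(ℝ, EG) ∞ G]
    [MulAction G M] [ContMDiffSMul 𝓘(ℝ, EG) 𝓘(ℝ, EM) ∞ G M]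
    -- the symplectic form, the compatible pair, the invariance
    (ωM : BilinField EM M) (hω : IsSymplecticForm ωM)
    (JM : EndField EM M) (hJ : IsAlmostComplexStructure JM)
    (gM : RiemMetric EM M) (hcompat : IsCompatible ωM JM gM.inner)
    (hsymp : IsInvariant G ωM) (hisom : IsInvariant G gM.inner)
    -- the equivariant momentum map
    (μ : M → (EG →L[ℝ] ℝ)) (hmom : IsMomentumMap G ωM μ) (hμ : IsEquivariant G μ)
    -- `β` is a regular value: `dμ` is onto along `μ⁻¹(β)`, which is an embedded submanifold
    (β : EG →L[ℝ] ℝ)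
    (hreg : ∀ x, μ x = β → Function.Surjective (mfderiv 𝓘(ℝ, EM) 𝓘(ℝ, EG →L[ℝ] ℝ) μ x))
    {EZ : Type*} [NormedAddCommGroup EZ] [NormedSpace ℝ EZ] [FiniteDimensional ℝ EZ]
    [ChartedSpace EZ (level hμ β)] [IsManifold 𝓘(ℝ, EZ) ∞ (level hμ β)]
    (hincl : Manifold.IsSmoothEmbedding 𝓘(ℝ, EZ) 𝓘(ℝ, EM) ∞ (incl hμ β))
    -- `G_β` acts freely and properly on `μ⁻¹(β)`
    (hfree : ∀ (a : isotropy G β) (z : level hμ β), a • z = z → a = 1)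
    (hproper : ProperSMul (isotropy G β) (level hμ β))
    -- the smooth structure of the quotient manifold: the one for which `π` is a submersion
    {EB : Type*} [NormedAddCommGroup EB] [NormedSpace ℝ EB] [FiniteDimensional ℝ EB]
    [ChartedSpace EB (Reduced hμ β)] [IsManifold 𝓘(ℝ, EB) ∞ (Reduced hμ β)]
    (hproj : Manifold.IsSubmersion 𝓘(ℝ, EZ) 𝓘(ℝ, EB) ∞ (proj hμ β)) :
    -- the reduced symplectic form exists and is unique
    (∃! ωβ : BilinField EB (Reduced hμ β),
      IsSymplecticForm ωβ ∧ pullback (E' := EZ) (proj hμ β) ωβ = pullback (E' := EZ) (incl hμ β) ωM) ∧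
    -- the endomorphism field induced by `J` on `μ⁻¹(β)` exists and is unique
    (∃! JZ : EndField EZ (level hμ β), IsInducedEndField (incl hμ β) gM.inner JM JZ) ∧
    ∀ (ωβ : BilinField EB (Reduced hμ β)) (JZ : EndField EZ (level hμ β)),
      IsSymplecticForm ωβ → pullback (E' := EZ) (proj hμ β) ωβ = pullback (E' := EZ) (incl hμ β) ωM →
      IsInducedEndField (incl hμ β) gM.inner JM JZ →
      -- for each almost complex structure on the reduced space
      (∀ Jβ : EndField EB (Reduced hμ β), IsAlmostComplexStructure Jβ →
        ((∃ gβ : RiemMetric EB (Reduced hμ β),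
            IsRiemannianSubmersion (proj hμ β) (pullback (E' := EZ) (incl hμ β) gM.inner) gβ.inner ∧
            IsCompatible ωβ Jβ gβ.inner) ↔
          IsAlmostComplexMap (proj hμ β) JZ Jβ)) ∧
      -- and hence for the existence of such a structure
      ((∃ (Jβ : EndField EB (Reduced hμ β)) (gβ : RiemMetric EB (Reduced hμ β)),
          IsAlmostComplexStructure Jβ ∧
          IsRiemannianSubmersion (proj hμ β) (pullback (E' := EZ) (incl hμ β) gM.inner) gβ.inner ∧
          IsCompatible ωβ Jβ gβ.inner) ↔
        ∃ Jβ : EndField EB (Reduced hμ β), IsAlmostComplexStructure Jβ ∧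
          IsAlmostComplexMap (proj hμ β) JZ Jβ) := by
  have hreg' : ∀ x, μ x = β → Function.Surjective (differential μ x : EM →L[ℝ] (EG →L[ℝ] ℝ)) := hreg
  have hinj := fun z ↦ injective_differential_of_isImmersionAt (hincl.isImmersion.isImmersionAt z)
  refine ⟨existsUnique_reduced_form hμ β hω hsymp hmom hreg' hincl hfree hproper hproj,
    existsUnique_isInducedEndField hcompat hinj, fun ωβ JZ hωβ hpull hJZ ↦ ?_⟩
  have key := fun Jβ (hJβ : IsAlmostComplexStructure Jβ) ↦
    exists_riemMetric_iff_isAlmostComplexMap hproj (proj_surjective hμ β) hinj hcompat hJZ hωβ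
      hpull hJβ
  refine ⟨key, ?_, ?_⟩
  · rintro ⟨Jβ, gβ, hJβ, hsub, hcβ⟩
    exact ⟨Jβ, hJβ, (key Jβ hJβ).1 ⟨gβ, hsub, hcβ⟩⟩
  · rintro ⟨Jβ, hJβ, hac⟩
    obtain ⟨gβ, hsub, hcβ⟩ := (key Jβ hJβ).2 hac
    exact ⟨Jβ, gβ, hJβ, hsub, hcβ⟩
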